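/- Let $K=\mathbb{C}$. For $m\ge 1$ let $\Delta_m\subseteq\mathbb{R}^m$ be the unit simplex, the convex hull of $0,e_1,\dots,e_m$, and for $n\ge1$ let $$K[(\Delta_m)^{\times n}]=K\Big[t^d\prod_{i=1}^n\prod_{j=1}^m x_{i,j}^{v_{i,j}} :\ d\in\mathbb{N},\ v\in d(\Delta_m)^{\times n}\cap\mathbb{Z}^{mn}\Big]\subseteq K[t,x_{1,1}^{\pm1},\dots,x_{n,m}^{\pm1}]$$ be the affine semigroup algebra of $(\Delta_m)^{\times n}$. A monic monomial $t^d\prod x_{i,j}^{v_{i,j}}$ has projective degree $d$ and combinatorial degree $\sum_{i,j} j\,v_{i,j}$. For $k\geq 1$ and $1\le i\le mn$ let $e^i_{m,n,k}=\sum_x x^k$, where $x$ runs over the monic monomials of $K[(\Delta_m)^{\times n}]$ of projective degree $1$ and combinatorial degree $i$. The sequence $t,\,e^1_{m,n,k},\,\dots,\,e^{mn}_{m,n,k}$ is a regular sequence in $K[(\Delta_m)^{\times n}]$, of maximal length among all regular sequences in this ring, for positive integers $m,n,k$ in each of the following cases: 1. $k=m=1$ and $n$ is arbitrary; 2. $k=1$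 and $m,n$ are arbitrary; 3. $m=1$ and $k,n$ are arbitrary; 4. (i) $m=2$ and $n,k\le 10$; (ii) $m=3$, $n=2$ and $k\le 7$; (iii) $m=4$, $n=2$ and $k\le 3$. Moreover, for all $m,n\ge1$, let $S_{(m^n)}=S_{I_1}\times\cdots\times S_{I_n}\subseteq S_{mn}$ be the Young subgroup of the blocks $I_i=\{(i-1)m+1,\dots,im\}$, acting on $K[(\Delta_1)^{\times mn}]$ by $t\mapsto t$, $x_{a,1}\mapsto x_{\sigma(a),1}$. There is an isomorphism of $K$-algebras $$\varphi: K[(\Delta_1)^{\times mn}]^{S_{(m^n)}}\xrightarrow{\ \sim\ }K[(\Delta_m)^{\times n}]$$ such that $$\varphi\Big(t\prod_{i=1}^n\sum_{J\subseteq I_i,\ |J|=j_i}\ \prod_{a\in J}x_{a,1}\Big)=t\prod_{i=1}^n x_{i,j_i}\qquad(0\le j_1,\dots,j_n\le m,\ \ x_{i,0}:=1),$$ and $\varphi(e^i_{1,mn,1})=e^i_{m,n,1}$ for $1\le i\le mn$ (in particular these elements on the left are invariant). -/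

import Mathlib

open scoped Pointwise

noncomputable section

/-! ### Affine semigroup algebras of lattice polytopes -/

/-- The ring `K[t, x_i^{±1} : i ∈ ι]`. The exponent `(d, v)` stands for the monomial
`t ^ d * ∏ i, x_i ^ (v i)`. -/
abbrev TLaurent (K ι : Type*) [Field K] : Type _ := AddMonoidAlgebra K (ℕ × (ι → ℤ))

namespace TLaurent

variable (K : Type*) [Field K] {ι : Type*}

/-- The monic monomial `x_{d,v} = t ^ d * ∏ i, x_i ^ (v i)`. -/
def mono (d : ℕ) (v : ι → ℤ) : TLaurent K ι := AddMonoidAlgebra.single (d, v) 1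

/-- The variable `t`. -/
def T : TLaurent K ι := mono K 1 0

/-- The variable `x_i`. -/
def X [DecidableEq ι] (i : ι) : TLaurent K ι := mono K 0 (Pi.single i 1)

end TLaurent

/-- The lattice points of the dilation `d P`. -/
def dilationLatticePoints {ι : Type*} (P : Set (ι → ℝ)) (d : ℕ) : Set (ι → ℤ) :=
  {v | (fun i => (v i : ℝ)) ∈ (d : ℝ) • P}

/-- The affine semigroup algebra `K[P] = K[x_{d,v} : d ∈ ℕ, v ∈ dP ∩ ℤ^ι]`. -/
def affineSemigroupAlgebra (K : Type*) [Field K] {ι : Type*} (P : Set (ι → ℝ)) :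
    Subalgebra K (TLaurent K ι) :=
  Algebra.adjoin K {f | ∃ (d : ℕ), ∃ v ∈ dilationLatticePoints P d, f = TLaurent.mono K d v}

/-- The monic monomials `x` of `K[P]` of projective degree (the exponent of `t`) equal to `d` and
of combinatorial degree `a · v` (with respect to the weight vector `a`) equal to `c`. -/
def monicMonomials (K : Type*) [Field K] {ι : Type*} [Fintype ι] (P : Set (ι → ℝ)) (a : ι → ℤ)
    (d : ℕ) (c : ℤ) : Set (affineSemigroupAlgebra K P) :=
  {x | ∃ v : ι → ℤ, (x : TLaurent K ι) = TLaurent.mono K d v ∧ ∑ i, a i * v i = c}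

/-! ### Products of unit simplices -/

/-- The `m`-dimensional unit simplex, the convex hull of `0, e_1, ..., e_m` in `ℝ^m`. -/
def unitSimplex (m : ℕ) : Set (Fin m → ℝ) :=
  convexHull ℝ (insert 0 (Set.range fun j : Fin m => (Pi.single j 1 : Fin m → ℝ)))

/-- The Cartesian power `P^{×n}`, in coordinates indexed by pairs `(i, j)` where `i` is the number
of the copy of `P`. -/
def cartesianPower {m : ℕ} (P : Set (Fin m → ℝ)) (n : ℕ) : Set (Fin n × Fin m → ℝ) :=
  {p | ∀ i : Fin n, (fun j => p (i, j)) ∈ P}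

/-- The weight vector `a = (a')^{×n}` for `a' = (1, 2, ..., m)`. -/
def simplexWeight (m n : ℕ) : Fin n × Fin m → ℤ := fun p => (p.2 : ℤ) + 1

/-- The algebra `K[(Δ_m)^{×n}]`. -/
abbrev segreAlgebra (K : Type*) [Field K] (m n : ℕ) :
    Subalgebra K (TLaurent K (Fin n × Fin m)) :=
  affineSemigroupAlgebra K (cartesianPower (unitSimplex m) n)

lemma zero_mem_unitSimplex (m : ℕ) : (0 : Fin m → ℝ) ∈ unitSimplex m :=
  subset_convexHull ℝ _ (Set.mem_insert _ _)

lemma T_mem_segreAlgebra (K : Type*) [Field K] (m n : ℕ) :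
    (TLaurent.T K : TLaurent K (Fin n × Fin m)) ∈ segreAlgebra K m n := by
  refine Algebra.subset_adjoin ⟨1, 0, ?_, rfl⟩
  refine ⟨0, fun i => zero_mem_unitSimplex m, ?_⟩
  ext p
  simp

/-- The element `e^0 = t` of `K[(Δ_m)^{×n}]`. -/
def segreT (K : Type*) [Field K] (m n : ℕ) : segreAlgebra K m n :=
  ⟨TLaurent.T K, T_mem_segreAlgebra K m n⟩

/-- The element `e^i_{m,n,k}`: the sum of `x ^ k` over the monic monomials `x` of `K[(Δ_m)^{×n}]`
of projective degree `1` and combinatorial degree `i`. This is a sum over a finite set, see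
`finite_monicMonomials_segre`. -/
def segreE (K : Type*) [Field K] (m n k : ℕ) (i : ℕ) : segreAlgebra K m n :=
  ∑ᶠ x ∈ monicMonomials K (cartesianPower (unitSimplex m) n) (simplexWeight m n) 1 (i : ℤ), x ^ k

/-- The sequence `t, e^1_{m,n,k}, ..., e^{mn}_{m,n,k}`. -/
def segreSequence (K : Type*) [Field K] (m n k : ℕ) : List (segreAlgebra K m n) :=
  segreT K m n :: List.ofFn (fun i : Fin (m * n) => segreE K m n k (i + 1))

/-- `rs` is a regular sequence in `R`, and no regular sequence in `R` is longer. -/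
def IsRegularOfMaximalLength {R : Type*} [CommRing R] (rs : List R) : Prop :=
  RingTheory.Sequence.IsRegular R rs ∧
    ∀ rs' : List R, RingTheory.Sequence.IsRegular R rs' → rs'.length ≤ rs.length

/-! ### Invariants under Young subgroups -/

/-- The action of `σ ∈ S_N` on `K[t, x_{i,j}^{±1}]` by `t ↦ t`, `x_{i,j} ↦ x_{σ(i),j}`. -/
def permAct (K : Type*) [Field K] {N m : ℕ} (σ : Equiv.Perm (Fin N)) :
    TLaurent K (Fin N × Fin m) →ₐ[K] TLaurent K (Fin N × Fin m) :=
  AddMonoidAlgebra.mapDomainAlgHom K K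
    ({ toFun := fun g => (g.1, fun p => g.2 (σ⁻¹ p.1, p.2))
       map_zero' := rfl
       map_add' := fun _ _ => rfl } : ℕ × (Fin N × Fin m → ℤ) →+ ℕ × (Fin N × Fin m → ℤ))

/-- The block `I_i = {im, im + 1, ..., im + m - 1}` of `{0, ..., mn - 1}`. -/
def youngBlock (m n : ℕ) (i : Fin n) : Finset (Fin (m * n)) :=
  Finset.univ.filter fun a => a.val / m = i.val

/-- The Young subgroup `S_{(m^n)}` of `S_{mn}`, of all permutations that preserve each block. -/
def youngSubgroup (m n : ℕ) : Subgroup (Equiv.Perm (Fin (m * n))) where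
  carrier := {σ | ∀ i : Fin n, ∀ a ∈ youngBlock m n i, σ a ∈ youngBlock m n i}
  one_mem' := fun _ _ h => h
  mul_mem' := fun hσ hτ i a h => hσ i _ (hτ i a h)
  inv_mem' := by
    intro σ hσ i a ha
    have hinj : Set.InjOn σ (youngBlock m n i : Set (Fin (m * n))) := σ.injective.injOn
    obtain ⟨b, hb, hba⟩ := Finset.surj_on_of_inj_on_of_card_le
      (s := youngBlock m n i) (t := youngBlock m n i) (fun a _ => σ a) (fun a h => hσ i a h)
      (fun a b _ _ h => σ.injective h) le_rfl a ha
    have : σ⁻¹ a = b := by rw [hba]; simp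
    rw [this]
    exact hb

/-- The algebra of invariants `K[(Δ_1)^{×mn}]^{S_{(m^n)}}`. -/
def youngInvariants (K : Type*) [Field K] (m n : ℕ) :
    Subalgebra K (TLaurent K (Fin (m * n) × Fin 1)) :=
  segreAlgebra K 1 (m * n) ⊓
    ⨅ σ ∈ youngSubgroup m n, AlgHom.equalizer (permAct K σ) (AlgHom.id K _)

/-- The element `x(j_1, ..., j_n) = t ∏_i ∑_{J ⊆ I_i, |J| = j_i} ∏_{a ∈ J} x_{a,1}`. -/
def youngGenerator (K : Type*) [Field K] (m n : ℕ) (j : Fin n → Fin (m + 1)) :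
    TLaurent K (Fin (m * n) × Fin 1) :=
  TLaurent.T K * ∏ i : Fin n, ∑ J ∈ (youngBlock m n i).powersetCard (j i),
    ∏ a ∈ J, TLaurent.X K (a, 0)

/-- The monomial `t ∏_i x_{i,j_i}`, where `x_{i,0} = 1`. -/
def segreMonomial (K : Type*) [Field K] (m n : ℕ) (j : Fin n → Fin (m + 1)) :
    TLaurent K (Fin n × Fin m) :=
  TLaurent.T K * ∏ i : Fin n, if h : j i = 0 then 1 else TLaurent.X K (i, (j i).pred h)

/-! ### The sum defining `e^i_{m,n,k}` is finite -/

lemma mem_of_mem_affineSemigroupAlgebra {K : Type*} [Field K] {ι : Type*} {P : Set (ι → ℝ)}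
    (hP : Convex ℝ P) (hne : P.Nonempty) {f : TLaurent K ι}
    (hf : f ∈ affineSemigroupAlgebra K P) :
    ∀ g ∈ f.coeff.support, g.2 ∈ dilationLatticePoints P g.1 := by
  classical
  have h0 : (0 : ι → ℤ) ∈ dilationLatticePoints P 0 := by
    obtain ⟨p, hp⟩ := hne
    exact ⟨p, hp, by ext; simp⟩
  refine Algebra.adjoin_induction (p := fun f _ => ∀ g ∈ f.coeff.support,
    g.2 ∈ dilationLatticePoints P g.1) ?_ ?_ ?_ ?_ hf
  · rintro _ ⟨d, v, hv, rfl⟩ g hg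
    have := Finsupp.support_single_subset hg
    rw [Finset.mem_singleton] at this
    subst this
    exact hv
  · intro r g hg
    have := Finsupp.support_single_subset hg
    rw [Finset.mem_singleton] at this
    subst this
    exact h0
  · intro a b _ _ ha hb g hg
    rcases Finset.mem_union.1 (Finsupp.support_add hg) with h | h
    exacts [ha g h, hb g h]
  · intro a b _ _ ha hb g hg
    obtain ⟨u, hu, w, hw, rfl⟩ := Finset.mem_add.1 (AddMonoidAlgebra.support_coeff_mul_subset a b hg)
    have h1 : (fun i => (u.2 i : ℝ)) ∈ (u.1 : ℝ) • P := ha u hu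
    have h2 : (fun i => (w.2 i : ℝ)) ∈ (w.1 : ℝ) • P := hb w hw
    have h3 := Set.add_mem_add h1 h2
    rw [← hP.add_smul (Nat.cast_nonneg _) (Nat.cast_nonneg _)] at h3
    change (fun i => ((u + w).2 i : ℝ)) ∈ (((u + w).1 : ℕ) : ℝ) • P
    rw [Prod.fst_add, Nat.cast_add]
    convert h3 using 1
    ext i
    simp

lemma cartesianPower_unitSimplex_subset (m n : ℕ) :
    cartesianPower (unitSimplex m) n ⊆ Set.Icc 0 1 := by
  intro p hp
  have h : unitSimplex m ⊆ Set.Icc 0 1 := by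
    refine convexHull_min ?_ (convex_Icc 0 1)
    rintro _ (rfl | ⟨j, rfl⟩)
    · exact ⟨le_rfl, zero_le_one⟩
    · refine ⟨fun i => ?_, fun i => ?_⟩ <;> by_cases hij : i = j <;> simp [hij]
  exact ⟨fun q => (h (hp q.1)).1 q.2, fun q => (h (hp q.1)).2 q.2⟩

lemma finite_monicMonomials_segre (K : Type*) [Field K] (m n : ℕ) (a : Fin n × Fin m → ℤ)
    (c : ℤ) : (monicMonomials K (cartesianPower (unitSimplex m) n) a 1 c).Finite := by
  have hconv : Convex ℝ (cartesianPower (unitSimplex m) n) := by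
    intro p hp q hq s t hs ht hst i
    exact convex_convexHull ℝ _ (hp i) (hq i) hs ht hst
  have hne : (cartesianPower (unitSimplex m) n).Nonempty := ⟨0, fun i => zero_mem_unitSimplex m⟩
  refine Set.Finite.of_finite_image (f := Subtype.val) ?_ Subtype.val_injective.injOn
  refine ((Set.finite_Icc (0 : Fin n × Fin m → ℤ) 1).image (TLaurent.mono K 1)).subset ?_
  rintro _ ⟨x, ⟨v, hv, _⟩, rfl⟩
  refine ⟨v, ?_, hv.symm⟩
  have hx := mem_of_mem_affineSemigroupAlgebra hconv hne x.2 (1, v)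
    (by rw [hv]; simp [TLaurent.mono])
  change (fun i => (v i : ℝ)) ∈ ((1 : ℕ) : ℝ) • cartesianPower (unitSimplex m) n at hx
  rw [Nat.cast_one, one_smul] at hx
  have := cartesianPower_unitSimplex_subset m n hx
  refine ⟨fun q => ?_, fun q => ?_⟩
  · have := this.1 q
    simpa using this
  · have := this.2 q
    simp only [Pi.one_apply] at this ⊢
    exact_mod_cast this

end

/-!
Let `N = m * n`. The tail sums `w (i, j) = ∑ l ≥ j, v (i, l)` turn the lattice points of the cone
over `(Δ_m)^{×n}` into the pairs `(d, w)` with `d ≥ w (i, 1) ≥ ⋯ ≥ w (i, m) ≥ 0` for all `i`.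
These form a Hibi monoid: the monomials `x_S` of degree `1` belong to the down-sets `S` of a
disjoint union of `n` chains, and the combinatorial degree is the number of elements of `S`. So
`t` and the `e^i` are the rank sums `∑ x_S ^ k` over the down-sets with `c` elements, for `c = 0,
…, N`, and the theorem holds for all positive `k`, over any field and for any finite poset.

*Exponent one.* List the coordinates of `w` in decreasing order, with ties broken by the index.
This gives a flag of down-sets, the top sets of `(d, w)`, and adding the indicator function of a
top set does not change the flag. Hence every monomial is, in a unique way, a reduced monomial
times a product of monomials of its top sets. Multiplication by the rank sum of rank `c` adds to a
leading monomial, for the majorization order, the top set with `c` elements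
(`Hibi.IsLead.rankSum_mul`). So the products of reduced monomials and rank sums form a basis
(`Hibi.rankBasis`), i.e. the algebra is free over the polynomial ring in the rank sums. This makes
the rank sums a regular sequence. There are finitely many reduced monomials, so that the algebra
is finite over this polynomial ring and its Krull dimension `N + 1` bounds the length of all
regular sequences (`Hibi.length_le_of_isRegular`).

*Any exponents.* A prime ideal that contains one rank sum of each rank contains all `x_S`: if
`x_S` with `S` of the smallest possible rank were missing, then `x_S x_T = x_{S ∩ T} x_{S ∪ T}`
would show that all other `x_T` of this rank belong to the ideal, and so would a power of `x_S`
(`Hibi.single_ind_mem_of_isPrime`). So rank sums with any exponents generate, up to radical, the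
same ideal. A regular sequence stays regular when its last member `a` is replaced by some `b` such
that a power of `a` lies in the new ideal, and regular sequences of homogeneous elements of
positive degree can be permuted. Thus the exponents can be changed one at a time
(`Hibi.isWeaklyRegular_rankSum`).

*The invariants.* The map that sends `x_{i,j}` to the elementary symmetric polynomial of degree
`j` in the variables of the block `I_i` sends the monomial of `(d, v)` to an invariant whose
leading monomial has the tail sums of `v` as exponents. These are the monomials with weakly
decreasing exponents in each block, and an invariant is determined by its coefficients there
(`Young.eq_zero_of_dominantPart_eq_zero`). By unitriangularity the map is an isomorphism onto the
algebra of invariants. Its inverse has the prescribed values, because a set of indices is the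
union of its intersections with the blocks (`Young.sum_youngGenerator`).
-/

/-! ### Unitriangular families and regular sequences -/

/-- Of two finite sets with the same number of elements, the one whose proper elements have the
smaller values has the smaller sum. -/
lemma Finset.sum_lt_sum_of_card_eq {ι : Type*} [DecidableEq ι] {s t : Finset ι} {f : ι → ℤ}
    (hc : s.card = t.card) (h : ∀ a ∈ s \ t, ∀ b ∈ t \ s, f a < f b) (hne : s ≠ t) :
    ∑ a ∈ s, f a < ∑ a ∈ t, f a := by
  have hc' : (s \ t).card = (t \ s).card := by
    have h1 := Finset.card_sdiff_add_card_inter s t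
    have h2 := Finset.card_sdiff_add_card_inter t s
    rw [Finset.inter_comm t s] at h2
    omega
  rw [← Finset.sum_inter_add_sum_sdiff s t, ← Finset.sum_inter_add_sum_sdiff t s,
    Finset.inter_comm t s]
  refine add_lt_add_right ?_ _
  rw [← Finset.sum_coe_sort (s \ t), ← Finset.sum_coe_sort (t \ s),
    ← (Finset.equivOfCardEq hc').sum_comp]
  refine Finset.sum_lt_sum_of_nonempty ?_ fun a _ => h a a.2 _ (Subtype.prop _)
  rw [Finset.univ_nonempty_iff, Finset.nonempty_coe_sort, Finset.sdiff_nonempty]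
  exact fun hsub => hne (Finset.eq_of_subset_of_card_le hsub hc.ge)

section Triangular

variable {K M : Type*} [Field K] {b : M → (M →₀ K)} {h : M → ℕ}

/-- Here `b m` has leading term `m` with respect to the grading `h`. -/
lemma linearIndependent_of_unitriangular (h1 : ∀ m, b m m = 1)
    (h2 : ∀ m, ∀ m' ∈ (b m).support, m' = m ∨ h m' < h m) : LinearIndependent K b := by
  classical
  rw [linearIndependent_iff]
  intro l hl
  by_contra hne
  obtain ⟨m, hm, hmax⟩ := l.support.exists_max_image h (Finsupp.support_nonempty_iff.2 hne)
  have := DFunLike.congr_fun hl m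
  rw [Finsupp.linearCombination_apply, Finsupp.sum, Finsupp.finsetSum_apply,
    Finset.sum_eq_single m] at this
  · simp [h1] at this
    exact (Finsupp.mem_support_iff.1 hm) this
  · intro m' hm' hne'
    by_contra h0
    have hs : m ∈ (b m').support := by
      rw [Finsupp.mem_support_iff]
      intro h3
      exact h0 (by simp [h3])
    rcases h2 m' m hs with h4 | h4
    · exact hne' h4.symm
    · exact absurd (hmax m' hm') (not_le.2 h4)
  · exact fun h => absurd hm h

lemma span_eq_top_of_unitriangular (h1 : ∀ m, b m m = 1)
    (h2 : ∀ m, ∀ m' ∈ (b m).support, m' = m ∨ h m' < h m) :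
    Submodule.span K (Set.range b) = ⊤ := by
  classical
  have key : ∀ n : ℕ, ∀ m, h m = n → Finsupp.single m (1 : K) ∈ Submodule.span K (Set.range b) := by
    intro n
    induction n using Nat.strong_induction_on with
    | _ n ih =>
      intro m hm
      have hrest : Finsupp.single m (1 : K) = b m - (b m).erase m := by
        rw [eq_sub_iff_add_eq]
        conv_rhs => rw [← Finsupp.single_add_erase m (b m), h1]
      rw [hrest]
      refine Submodule.sub_mem _ (Submodule.subset_span ⟨m, rfl⟩) ?_
      rw [← Finsupp.sum_single ((b m).erase m)]
      refine Submodule.sum_mem _ fun m' hm' => ?_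
      rw [Finsupp.support_erase, Finset.mem_erase] at hm'
      rw [← mul_one (((b m).erase m) m'), ← smul_eq_mul, ← Finsupp.smul_single]
      refine Submodule.smul_mem _ _ (ih (h m') ?_ m' rfl)
      rcases h2 m m' hm'.2 with h4 | h4
      · exact absurd h4 hm'.1
      · omega
  rw [eq_top_iff]
  intro f _
  rw [← Finsupp.sum_single f]
  refine Submodule.sum_mem _ fun m _ => ?_
  rw [← mul_one (f m), ← smul_eq_mul, ← Finsupp.smul_single]
  exact Submodule.smul_mem _ _ (key _ m rfl)

end Triangular

open RingTheory.Sequence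

/-- If an algebra has a basis of the form `η * ∏ θ_i ^ α_i`, i.e. it is free over the polynomial
ring in the `θ_i`, then the `θ_i` form a weakly regular sequence. -/
lemma isWeaklyRegular_ofFn_of_basis {K A Y : Type*} [Field K] [CommRing A] [Algebra K A] {n : ℕ}
    (θ : Fin n → A) (b : Module.Basis (Y × Multiset (Fin n)) K A)
    (hb : ∀ i y α, θ i * b (y, α) = b (y, i ::ₘ α)) :
    IsWeaklyRegular A (List.ofFn θ) := by
  classical
  have hrepr : ∀ (i : Fin n) (x : A),
      b.repr (θ i * x) = (b.repr x).mapDomain fun p => (p.1, i ::ₘ p.2) := by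
    intro i x
    have : b.repr.toLinearMap ∘ₗ LinearMap.mulLeft K (θ i) =
        Finsupp.lmapDomain K K (fun p : Y × Multiset (Fin n) => (p.1, i ::ₘ p.2)) ∘ₗ
          b.repr.toLinearMap := by
      refine b.ext fun p => ?_
      simp [hb, Finsupp.lmapDomain_apply]
    exact LinearMap.congr_fun this x
  refine ⟨fun i hi => ?_⟩
  have hi' : i < n := by simpa using hi
  rw [isSMulRegular_quotient_iff_mem_of_smul_mem]
  -- The ideal of the first `i` members is spanned by the basis elements that they divide.
  set s : Set (Y × Multiset (Fin n)) := {p | ∃ j ∈ p.2, j.val < i} with hs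
  have hmul : ∀ (j : Fin n) (a : A), j.val < i → θ j * a ∈ Submodule.span K (b '' s) := by
    intro j a hj
    rw [b.mem_span_image, hrepr]
    intro p hp
    obtain ⟨q, _, rfl⟩ := Finset.mem_image.1 (Finsupp.mapDomain_support hp)
    exact ⟨j, Multiset.mem_cons_self _ _, hj⟩
  have hmem : ∀ x : A, x ∈ (Ideal.ofList ((List.ofFn θ).take i) • ⊤ : Submodule A A) ↔
      x ∈ Submodule.span K (b '' s) := by
    intro x
    rw [smul_eq_mul, Ideal.mul_top]
    have hset : {r | r ∈ (List.ofFn θ).take i} = θ '' {j | j.val < i} := by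
      ext r
      simp only [Set.mem_ofPred_eq, List.mem_take_iff_getElem, List.getElem_ofFn, List.length_ofFn,
        Set.mem_image]
      constructor
      · rintro ⟨j, hj, rfl⟩
        exact ⟨⟨j, by omega⟩, by change j < i; omega, rfl⟩
      · rintro ⟨j, hj, rfl⟩
        exact ⟨j, by change j.val < i at hj; omega, rfl⟩
    rw [Ideal.ofList, hset]
    constructor
    · intro hx
      induction hx using Submodule.span_induction with
      | zero => exact zero_mem _
      | add x y _ _ hx hy => exact add_mem hx hy
      | mem x hx =>
        obtain ⟨j, hj, rfl⟩ := hx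
        simpa using hmul j 1 hj
      | smul a x hx' hx =>
        clear hx'
        induction hx using Submodule.span_induction with
        | zero => simp
        | add x y _ _ hx hy => rw [smul_add]; exact add_mem hx hy
        | smul c x _ hx => rw [smul_comm]; exact Submodule.smul_mem _ _ hx
        | mem x hx =>
          obtain ⟨⟨y, α⟩, ⟨j, hj, hji⟩, rfl⟩ := hx
          obtain ⟨α, rfl⟩ := Multiset.exists_cons_of_mem hj
          rw [← hb, smul_eq_mul, mul_left_comm]
          exact hmul j _ hji
    · intro hx
      induction hx using Submodule.span_induction with
      | zero => exact zero_mem _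
      | add x y _ _ hx hy => exact add_mem hx hy
      | smul a x _ hx =>
        rw [Algebra.smul_def]
        exact Ideal.mul_mem_left _ _ hx
      | mem x hx =>
        obtain ⟨⟨y, α⟩, ⟨j, hj, hji⟩, rfl⟩ := hx
        obtain ⟨α, rfl⟩ := Multiset.exists_cons_of_mem hj
        rw [← hb]
        exact Ideal.mul_mem_right _ _ (Ideal.subset_span ⟨j, hji, rfl⟩)
  intro x hx
  rw [hmem, b.mem_span_image] at hx ⊢
  rw [List.getElem_ofFn, smul_eq_mul, hrepr] at hx
  intro p hp
  have hinj : Function.Injective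
      fun p : Y × Multiset (Fin n) => (p.1, (⟨i, hi'⟩ : Fin n) ::ₘ p.2) := fun p q hpq => by
      simp only [Prod.mk.injEq, Multiset.cons_inj_right] at hpq
      exact Prod.ext hpq.1 hpq.2
  have hp' : (p.1, (⟨i, hi'⟩ : Fin n) ::ₘ p.2) ∈
      ((b.repr x).mapDomain fun p => (p.1, (⟨i, hi'⟩ : Fin n) ::ₘ p.2)).support := by
    rw [Finsupp.mem_support_iff, Finsupp.mapDomain_apply hinj]
    exact Finsupp.mem_support_iff.1 hp
  obtain ⟨j, hj, hji⟩ := hx hp'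
  rcases Multiset.mem_cons.1 hj with rfl | hj
  · exact absurd hji (lt_irrefl _)
  · exact ⟨j, hj, hji⟩

/-! ### Lengths of regular sequences -/

/-- Dividing by a regular element lowers the dimension, since it avoids the minimal primes. -/
lemma length_add_supportDim_le_of_isRegular {R : Type*} [CommRing R] [IsNoetherianRing R]
    (rs : List R) : ∀ {M : Type*} [AddCommGroup M] [Module R M] [Module.Finite R M],
      IsRegular M rs →
      Module.supportDim R (M ⧸ (Ideal.ofList rs • ⊤ : Submodule R M)) + rs.length ≤
        Module.supportDim R M := by
  induction rs with
  | nil =>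
    intro M _ _ _ _
    rw [Ideal.ofList_nil, Submodule.bot_smul]
    simpa using (Module.supportDim_eq_of_equiv (Submodule.quotEquivOfEqBot ⊥ rfl)).le
  | cons x rs ih =>
    intro M _ _ _ reg
    rw [isRegular_cons_iff] at reg
    have h1 := ih reg.2
    have h2 := Module.supportDim_quotSMulTop_succ_le_of_notMem_minimalPrimes (R := R) (M := M)
      (x := x) (fun _ => reg.1.notMem_of_mem_minimalPrimes)
    rw [Module.supportDim_eq_of_equiv
      (Submodule.quotOfListConsSMulTopEquivQuotSMulTopInner M x rs)]
    refine le_trans ?_ h2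
    rw [List.length_cons, Nat.cast_add, Nat.cast_one, ← add_assoc]
    gcongr

lemma length_le_ringKrullDim_of_isRegular {R : Type*} [CommRing R] [IsNoetherianRing R]
    {rs : List R} (h : IsRegular R rs) : (rs.length : WithBot ℕ∞) ≤ ringKrullDim R := by
  have := h.quot_ofList_smul_nontrivial
  rw [← Module.supportDim_self_eq_ringKrullDim]
  refine le_trans ?_ (length_add_supportDim_le_of_isRegular rs h)
  refine le_add_of_nonneg_left ?_
  obtain ⟨n, hn⟩ := WithBot.ne_bot_iff_exists.1
    ((Module.supportDim_ne_bot_iff_nontrivial R _).2 (this ⊤))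
  rw [← hn]
  exact WithBot.coe_le_coe.2 zero_le

/-- Incomparability of primes in an integral extension bounds the Krull dimension. -/
lemma ringKrullDim_le_of_isIntegral {R S : Type*} [CommRing R] [CommRing S] [Algebra R S]
    [Algebra.IsIntegral R S] : ringKrullDim S ≤ ringKrullDim R := by
  refine Order.krullDim_le_of_strictMono (PrimeSpectrum.comap (algebraMap R S)) ?_
  intro p q hpq
  exact Ideal.IsIntegral.comap_lt_comap (R := R) hpq

/-! ### Hibi monoids -/

/-- The monoid of all `(d, w)` with `0 ≤ w a ≤ d` for all `a`, and `w b ≤ w a` whenever `r a b`.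
If `r` is a partial order then its algebra is the Hibi ring of the distributive lattice of the
down-sets of `r`. -/
def hibiMonoid {N : ℕ} (r : Fin N → Fin N → Prop) : AddSubmonoid (ℕ × (Fin N → ℤ)) where
  carrier := {m | (∀ a, 0 ≤ m.2 a) ∧ (∀ a, m.2 a ≤ m.1) ∧ ∀ a b, r a b → m.2 b ≤ m.2 a}
  zero_mem' := by simp
  add_mem' := by
    rintro x y ⟨h1, h2, h3⟩ ⟨h4, h5, h6⟩
    refine ⟨fun a => add_nonneg (h1 a) (h4 a), fun a => ?_,
      fun a b h => add_le_add (h3 a b h) (h6 a b h)⟩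
    have := h2 a
    have := h5 a
    simp only [Prod.snd_add, Pi.add_apply, Prod.fst_add]
    push_cast
    linarith

namespace Hibi

variable {N : ℕ} {r : Fin N → Fin N → Prop}

/-- The down-sets of `r`. -/
def IsDown (r : Fin N → Fin N → Prop) (S : Finset (Fin N)) : Prop := ∀ a b, r a b → b ∈ S → a ∈ S

/-- The element of degree `1` that is given by the indicator function of a down-set. -/
def ind (S : {S : Finset (Fin N) // IsDown r S}) : hibiMonoid r :=
  ⟨(1, fun a => if a ∈ S.1 then 1 else 0), by
    refine ⟨fun a => ?_, fun a => ?_, fun a b h => ?_⟩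
    · dsimp only; split_ifs <;> simp
    · dsimp only; split_ifs <;> simp
    · have := S.2 a b h
      dsimp only
      split_ifs <;> simp_all⟩

/-- The degree of an element `(d, w)` is `d`. -/
def deg (m : hibiMonoid r) : ℕ := m.1.1

/-- The coordinate `w a` of an element `(d, w)`. -/
def wt (m : hibiMonoid r) (a : Fin N) : ℤ := m.1.2 a

lemma wt_nonneg (m : hibiMonoid r) (a : Fin N) : 0 ≤ wt m a := m.2.1 a
lemma wt_le_deg (m : hibiMonoid r) (a : Fin N) : wt m a ≤ deg m := m.2.2.1 a
lemma wt_antitone (m : hibiMonoid r) {a b : Fin N} (h : r a b) : wt m b ≤ wt m a := m.2.2.2 a b h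

lemma wt_add (m m' : hibiMonoid r) (a : Fin N) : wt (m + m') a = wt m a + wt m' a := rfl
lemma deg_add (m m' : hibiMonoid r) : deg (m + m') = deg m + deg m' := rfl
lemma wt_ind (S : {S : Finset (Fin N) // IsDown r S}) (a : Fin N) :
    wt (ind S) a = if a ∈ S.1 then 1 else 0 := rfl
lemma deg_ind (S : {S : Finset (Fin N) // IsDown r S}) : deg (ind S) = 1 := rfl

lemma ext {m m' : hibiMonoid r} (h1 : deg m = deg m') (h2 : ∀ a, wt m a = wt m' a) : m = m' :=
  Subtype.ext (Prod.ext h1 (funext h2))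

lemma ind_injective : Function.Injective (ind (r := r)) := by
  intro S T h
  refine Subtype.ext (Finset.ext fun a => ?_)
  have := congrArg (fun m => wt m a) h
  simp only [wt_ind] at this
  split_ifs at this <;> simp_all

/-! ### The sorting permutation of an element -/

/-- A perturbation of `w` with pairwise distinct coordinates: among equal coordinates of `w` those
with smaller index get the larger values. -/
def pert (m : hibiMonoid r) (a : Fin N) : ℤ := N * wt m a + (N - 1 - a.val)

lemma pert_add_ind (m : hibiMonoid r) (S : {S : Finset (Fin N) // IsDown r S}) (a : Fin N) :
    pert (m + ind S) a = pert m a + if a ∈ S.1 then (N : ℤ) else 0 := by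
  simp only [pert, wt_add, wt_ind]
  split_ifs <;> ring

lemma pert_lt_iff (m m' : hibiMonoid r) (a b : Fin N) :
    pert m b < pert m' a ↔ wt m b < wt m' a ∨ wt m b = wt m' a ∧ a < b := by
  have ha := a.2
  have hb := b.2
  have hN : (0 : ℤ) < N := by omega
  unfold pert
  rcases lt_trichotomy (wt m b) (wt m' a) with h | h | h
  · have : (N : ℤ) * (wt m b + 1) ≤ N * wt m' a := mul_le_mul_of_nonneg_left h hN.le
    simp only [h, true_or, iff_true]
    rw [mul_add] at this
    omega
  · rw [h]
    simp only [lt_self_iff_false, false_or, true_and, Fin.lt_def]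
    omega
  · have : (N : ℤ) * (wt m' a + 1) ≤ N * wt m b := mul_le_mul_of_nonneg_left h hN.le
    simp only [h.not_gt, h.ne', false_and, or_self, iff_false, not_lt]
    rw [mul_add] at this
    omega

lemma pert_eq_iff (m m' : hibiMonoid r) (a b : Fin N) :
    pert m b = pert m' a ↔ wt m b = wt m' a ∧ a = b := by
  constructor
  · intro h
    have h1 := (pert_lt_iff m m' a b).not.1 h.not_lt
    have h2 := (pert_lt_iff m' m b a).not.1 h.not_gt
    have h3 : wt m b = wt m' a := by omega
    refine ⟨h3, ?_⟩
    simp only [h3, true_and, not_or, lt_self_iff_false, not_false_eq_true] at h1 h2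
    omega
  · rintro ⟨h, rfl⟩
    simp [pert, h]

lemma pert_injective (m : hibiMonoid r) : Function.Injective (pert m) :=
  fun a b h => ((pert_eq_iff m m b a).1 h).2.symm

/-- The rank of a coordinate when the values of `pert m` are listed in decreasing order. -/
def rk (m : hibiMonoid r) : Equiv.Perm (Fin N) := (Tuple.sort fun a => -pert m a)⁻¹

lemma rk_lt_iff (m : hibiMonoid r) (a b : Fin N) : rk m a < rk m b ↔ pert m b < pert m a := by
  have hm : StrictMono ((fun a => -pert m a) ∘ Tuple.sort fun a => -pert m a) :=
    (Tuple.monotone_sort _).strictMono_of_injective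
      ((neg_injective.comp (pert_injective m)).comp (Equiv.injective _))
  rw [← hm.lt_iff_lt]
  simp [rk]

lemma rk_eq_of_pert {m m' : hibiMonoid r}
    (h : ∀ a b, pert m b < pert m a → pert m' b < pert m' a) : rk m = rk m' := by
  have h1 : StrictMono (rk m' ∘ (rk m).symm) := by
    intro p q hpq
    simp only [Function.comp, rk_lt_iff]
    apply h
    rw [← rk_lt_iff]
    simpa using hpq
  have h2 : rk m' ∘ (rk m).symm = id := by
    have := Subsingleton.elim
      (h1.orderIsoOfSurjective _ ((rk m').surjective.comp (rk m).symm.surjective))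
      (OrderIso.refl _)
    exact congrArg DFunLike.coe this
  ext a
  have := congrFun h2 (rk m a)
  simp at this
  rw [this]

/-- The set of the first `i` coordinates in the order given by `rk m`. -/
def topSet (m : hibiMonoid r) (i : ℕ) : Finset (Fin N) :=
  Finset.univ.filter fun a => (rk m a).val < i

lemma mem_topSet {m : hibiMonoid r} {i : ℕ} {a : Fin N} : a ∈ topSet m i ↔ (rk m a).val < i := by
  simp [topSet]

lemma card_topSet (m : hibiMonoid r) {i : ℕ} (hi : i ≤ N) : (topSet m i).card = i := by
  have : (topSet m i).map (rk m).toEmbedding = Finset.univ.filter fun p : Fin N => p.val < i := by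
    ext p
    simp [topSet]
  rw [← Finset.card_map (rk m).toEmbedding, this]
  rw [Fin.card_filter_val_lt, min_eq_right hi]

/-- Top sets are down-sets when `r` is compatible with the order of the indices, because `pert`
breaks ties in favour of the smaller index. -/
lemma isDown_topSet (hr : ∀ a b, r a b → a < b) (m : hibiMonoid r) (i : ℕ) :
    IsDown r (topSet m i) := by
  intro a b hab hb
  rw [mem_topSet] at hb ⊢
  refine lt_trans ?_ hb
  rw [← Fin.lt_def, rk_lt_iff, pert_lt_iff]
  have := wt_antitone m hab
  have := hr a b hab
  omega

end Hibi

namespace Hibi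

variable {N : ℕ} {r : Fin N → Fin N → Prop}

lemma sum_pert_le (m : hibiMonoid r) (S : Finset (Fin N)) :
    ∑ a ∈ S, pert m a ≤ ∑ a ∈ topSet m S.card, pert m a := by
  classical
  by_cases hne : S = topSet m S.card
  · rw [← hne]
  have hc : S.card = (topSet m S.card).card := (card_topSet m (by simpa using S.card_le_univ)).symm
  refine (Finset.sum_lt_sum_of_card_eq hc (fun a ha b hb => ?_) hne).le
  rw [Finset.mem_sdiff, mem_topSet] at ha hb
  rw [← rk_lt_iff, Fin.lt_def]
  omega

/-! ### Adding a top set -/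

variable (hr : ∀ a b, r a b → a < b)

/-- The top set of `i` coordinates, as a down-set of `r`. -/
def topDown (m : hibiMonoid r) (i : ℕ) : {S : Finset (Fin N) // IsDown r S} :=
  ⟨topSet m i, isDown_topSet hr m i⟩

/-- Adding the indicator function of a top set keeps the order of the coordinates. -/
lemma rk_add_topDown (m : hibiMonoid r) (i : ℕ) : rk (m + ind (topDown hr m i)) = rk m := by
  refine (rk_eq_of_pert fun a b hab => ?_).symm
  simp only [pert_add_ind, topDown, mem_topSet]
  rw [← rk_lt_iff] at hab
  have hab' := (rk_lt_iff m a b).1 hab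
  rw [Fin.lt_def] at hab
  split_ifs <;> omega

lemma topSet_congr {m m' : hibiMonoid r} (h : rk m = rk m') : topSet m = topSet m' := by
  funext i
  ext a
  simp [mem_topSet, h]

lemma topDown_congr {m m' : hibiMonoid r} (h : rk m = rk m') : topDown hr m = topDown hr m' := by
  funext i
  exact Subtype.ext (congrFun (topSet_congr h) i)

/-- The `i`-th gap in the decreasing list of the values of `pert m` is larger than `N`, where the
list is preceded by the degree and followed by `0`. This says that the indicator function of the
top set of `i` coordinates can be subtracted without changing the order of the coordinates. -/
structure BigGap (m : hibiMonoid r) (i : ℕ) : Prop where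
  deg_pos : 0 < deg m
  lt_deg : ∀ b, i ≤ (rk m b).val → wt m b < deg m
  wt_pos : ∀ a, (rk m a).val < i → 0 < wt m a
  gap : ∀ a b, (rk m a).val < i → i ≤ (rk m b).val → pert m b + N < pert m a

lemma bigGap_add_topDown (m : hibiMonoid r) (i : ℕ) : BigGap (m + ind (topDown hr m i)) i := by
  refine ⟨by simp [deg_add, deg_ind], fun b hb => ?_, fun a ha => ?_, fun a b ha hb => ?_⟩
  · rw [rk_add_topDown] at hb
    have := wt_le_deg m b
    rw [wt_add, wt_ind, topDown, if_neg (by simpa [mem_topSet] using hb), deg_add, deg_ind]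
    push_cast
    omega
  · rw [rk_add_topDown] at ha
    have := wt_nonneg m a
    rw [wt_add, wt_ind, topDown, if_pos (by simpa [mem_topSet] using ha)]
    omega
  · rw [rk_add_topDown] at ha hb
    rw [pert_add_ind _ _ a, pert_add_ind _ _ b, topDown, if_neg (by simpa [mem_topSet] using hb),
      if_pos (by simpa [mem_topSet] using ha)]
    have : pert m b < pert m a := by
      rw [← rk_lt_iff, Fin.lt_def]
      omega
    omega

lemma wt_lt_of_gap {m : hibiMonoid r} {a b : Fin N} (h : pert m b + N < pert m a) :
    wt m b < wt m a := by
  have ha := a.2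
  have hb := b.2
  unfold pert at h
  by_contra hlt
  have : (N : ℤ) * wt m a ≤ N * wt m b := mul_le_mul_of_nonneg_left (not_lt.1 hlt) (by omega)
  omega

lemma wt_le_of_rk_le {m : hibiMonoid r} {a b : Fin N} (h : rk m a ≤ rk m b) : wt m b ≤ wt m a := by
  rcases h.lt_or_eq with h | h
  · rw [rk_lt_iff, pert_lt_iff] at h
    omega
  · rw [(rk m).injective h]

/-- Adding the top set of `j` coordinates only changes the `j`-th gap. -/
lemma BigGap.of_add_topDown {m : hibiMonoid r} {i j : ℕ} (hi : i ≤ N) (hj : j ≤ N) (hij : j ≠ i)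
    (h : BigGap (m + ind (topDown hr m j)) i) : BigGap m i := by
  have hp : ∀ a, pert (m + ind (topDown hr m j)) a =
      pert m a + if (rk m a).val < j then (N : ℤ) else 0 := by
    intro a
    simp [pert_add_ind, topDown, mem_topSet]
  have hw : ∀ a, wt (m + ind (topDown hr m j)) a =
      wt m a + if (rk m a).val < j then 1 else 0 := by
    intro a
    simp [wt_add, wt_ind, topDown, mem_topSet]
  obtain ⟨h1, h2, h3, h4⟩ := h
  simp only [rk_add_topDown, hp, hw, deg_add, deg_ind] at h1 h2 h3 h4
  push_cast at h2
  -- The coordinate just after the top set of `j` elements, or of `i` elements, bounds the others.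
  rcases lt_or_gt_of_ne hij with hlt | hlt
  · set c := (rk m).symm ⟨j, by omega⟩ with hc
    have hrc : (rk m c).val = j := by simp [hc]
    have hcpos := h3 c (by omega)
    rw [if_neg (by omega), add_zero] at hcpos
    have hcd := wt_le_deg m c
    have hgap : ∀ b, i ≤ (rk m b).val → pert m b + N < pert m c := by
      intro b hb
      have := h4 c b (by omega) hb
      rwa [if_neg (by omega), if_neg (by omega), add_zero, add_zero] at this
    refine ⟨by omega, fun b hb => ?_, fun a ha => ?_, fun a b ha hb => ?_⟩
    · have := wt_lt_of_gap (hgap b hb)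
      omega
    · by_cases haj : (rk m a).val ≤ j
      · have := wt_le_of_rk_le (m := m) (a := a) (b := c) (by rw [Fin.le_def]; omega)
        omega
      · have := h3 a ha
        rwa [if_neg (by omega), add_zero] at this
    · by_cases haj : (rk m a).val < j
      · have h5 := hgap b hb
        have h6 : pert m c < pert m a := by rw [← rk_lt_iff, Fin.lt_def]; omega
        omega
      · have := h4 a b ha hb
        rwa [if_neg (by omega), if_neg (by omega), add_zero, add_zero] at this
  · set c := (rk m).symm ⟨i, by omega⟩ with hc
    have hrc : (rk m c).val = i := by simp [hc]
    have hcd := h2 c (by omega)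
    rw [if_pos (by omega)] at hcd
    have hc0 := wt_nonneg m c
    have hgap : ∀ a, (rk m a).val < i → pert m c + N < pert m a := by
      intro a ha
      have := h4 a c ha (by omega)
      rw [if_pos (by omega), if_pos (by omega)] at this
      omega
    refine ⟨by omega, fun b hb => ?_, fun a ha => ?_, fun a b ha hb => ?_⟩
    · have := wt_le_of_rk_le (m := m) (a := c) (b := b) (by rw [Fin.le_def]; omega)
      omega
    · have := wt_lt_of_gap (hgap a ha)
      omega
    · have h5 := hgap a ha
      rcases hb.eq_or_lt with hb' | hb'
      · rw [(rk m).injective (Fin.ext (show (rk m b).val = (rk m c).val by omega))]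
        exact h5
      · have h6 : pert m b < pert m c := by rw [← rk_lt_iff, Fin.lt_def]; omega
        omega

lemma BigGap.exists_eq_add {m : hibiMonoid r} {i : ℕ} (h : BigGap m i) :
    ∃ m' : hibiMonoid r, m = m' + ind (topDown hr m' i) := by
  have hpos := h.deg_pos
  set w : Fin N → ℤ := fun a => wt m a - if (rk m a).val < i then 1 else 0 with hw
  have hp : ∀ a, (N : ℤ) * w a + (N - 1 - a.val) =
      pert m a - if (rk m a).val < i then (N : ℤ) else 0 := by
    intro a
    simp only [hw, pert]
    split_ifs <;> ring
  have hlt : ∀ a b, pert m b < pert m a →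
      (N : ℤ) * w b + (N - 1 - b.val) < N * w a + (N - 1 - a.val) := by
    intro a b hab
    have hrk := (rk_lt_iff m a b).2 hab
    rw [Fin.lt_def] at hrk
    rw [hp, hp]
    have := h.gap a b
    split_ifs <;> omega
  have hmem : (deg m - 1, w) ∈ hibiMonoid r := by
    refine ⟨fun a => ?_, fun a => ?_, fun a b hab => ?_⟩
    · have h1 := wt_nonneg m a
      have h2 := h.wt_pos a
      simp only [hw]
      split_ifs <;> omega
    · have h1 := wt_le_deg m a
      have h2 := h.lt_deg a
      simp only [hw]
      split_ifs <;> omega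
    · have h1 := hlt a b ((pert_lt_iff m m a b).2 (by
        have := wt_antitone m hab
        have := hr a b hab
        omega))
      have ha := a.2
      have hb := b.2
      by_contra h2
      have : (N : ℤ) * (w a + 1) ≤ N * w b := mul_le_mul_of_nonneg_left (by
        change ¬ w b ≤ w a at h2
        omega) (by omega)
      rw [mul_add] at this
      omega
  set m' : hibiMonoid r := ⟨_, hmem⟩ with hm'
  have hrk : rk m = rk m' := rk_eq_of_pert hlt
  refine ⟨m', ext ?_ fun a => ?_⟩
  · change deg m = deg m - 1 + 1
    omega
  · rw [wt_add, wt_ind]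
    change wt m a = w a + _
    simp only [topDown, mem_topSet, ← hrk, hw]
    split_ifs <;> omega

lemma exists_of_add_topDown_eq {m m' : hibiMonoid r} {i j : ℕ} (hi : i ≤ N) (hj : j ≤ N)
    (hij : j ≠ i) (h : m + ind (topDown hr m i) = m' + ind (topDown hr m' j)) :
    ∃ m'', m' = m'' + ind (topDown hr m'' i) := by
  have := bigGap_add_topDown hr m i
  rw [h] at this
  exact (this.of_add_topDown hr hi hj hij).exists_eq_add hr

/-! ### Leading terms -/

variable {K : Type*} [Field K]

/-- The element `m` is the leading monomial of `f`, with coefficient `1`: all monomials of `f` have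
the same degree, and their perturbed exponent vectors are majorized by that of `m`. -/
structure IsLead (f : AddMonoidAlgebra K (hibiMonoid r)) (m : hibiMonoid r) : Prop where
  coeff_eq : f.coeff m = 1
  majorized : ∀ m' ∈ f.coeff.support, deg m' = deg m ∧
    ∀ S : Finset (Fin N), ∑ a ∈ S, pert m' a ≤ ∑ a ∈ topSet m S.card, pert m a

lemma isLead_single (m : hibiMonoid r) : IsLead (AddMonoidAlgebra.single m (1 : K)) m := by
  refine ⟨by simp, fun m' hm' => ?_⟩
  have := Finsupp.support_single_subset hm'
  rw [Finset.mem_singleton] at this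
  subst this
  exact ⟨rfl, sum_pert_le m'⟩

open Classical in
/-- The sum of the `k`-th powers of the monomials of degree `1` that belong to the down-sets with
`c` elements. -/
noncomputable def rankSum (K : Type*) [Field K] (r : Fin N → Fin N → Prop) (c k : ℕ) :
    AddMonoidAlgebra K (hibiMonoid r) :=
  ∑ S : {S : Finset (Fin N) // IsDown r S} with S.1.card = c,
    (AddMonoidAlgebra.single (ind S) 1) ^ k

lemma sum_pert_add_ind (m : hibiMonoid r) (S : {S : Finset (Fin N) // IsDown r S})
    (T : Finset (Fin N)) :
    ∑ a ∈ T, pert (m + ind S) a = ∑ a ∈ T, pert m a + N * (T ∩ S.1).card := by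
  simp only [pert_add_ind, Finset.sum_add_distrib, Finset.sum_ite_mem, Finset.sum_const,
    nsmul_eq_mul]
  rw [mul_comm]

lemma topSet_inter_topSet (m : hibiMonoid r) (i j : ℕ) :
    topSet m i ∩ topSet m j = topSet m (min i j) := by
  ext a
  simp [mem_topSet]

/-- A down-set with `i` elements meets a set `T` in at most `min |T| i` elements, and the top set of
`i` coordinates attains this bound on all top sets. So it contributes the leading monomial. -/
lemma IsLead.rankSum_mul {f : AddMonoidAlgebra K (hibiMonoid r)} {m : hibiMonoid r}
    (hf : IsLead f m) {i : ℕ} (hi : i ≤ N) :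
    IsLead (rankSum K r i 1 * f) (m + ind (topDown hr m i)) := by
  classical
  have hcoeff : ∀ (S : {S : Finset (Fin N) // IsDown r S}) (m'' : hibiMonoid r),
      (AddMonoidAlgebra.single (ind S) (1 : K) * f).coeff m'' ≠ 0 →
      ∃ m' ∈ f.coeff.support, m'' = ind S + m' := by
    intro S m'' h
    obtain ⟨x, hx, y, hy, rfl⟩ := Finset.mem_add.1
      (AddMonoidAlgebra.support_coeff_mul_subset _ _ (Finsupp.mem_support_iff.2 h))
    have := Finsupp.support_single_subset hx
    rw [Finset.mem_singleton] at this
    exact ⟨y, hy, by rw [this]⟩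
  have hexp : ∀ m'', (rankSum K r i 1 * f).coeff m'' =
      ∑ S : {S : Finset (Fin N) // IsDown r S} with S.1.card = i,
        (AddMonoidAlgebra.single (ind S) (1 : K) * f).coeff m'' := by
    intro m''
    simp only [rankSum, pow_one, Finset.sum_mul, AddMonoidAlgebra.coeff_sum,
      Finsupp.finsetSum_apply]
  refine ⟨?_, fun m'' hm'' => ?_⟩
  · rw [hexp, Finset.sum_eq_single (topDown hr m i)]
    · rw [add_comm m]
      rw [AddMonoidAlgebra.coeff_single_mul_add, hf.coeff_eq, one_mul]
    · intro S hS hne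
      by_contra h
      obtain ⟨m', hm', heq⟩ := hcoeff S _ h
      refine hne (Subtype.ext ?_)
      -- Compare the sums of the coordinates over the top set of `m`.
      rw [add_comm (ind S)] at heq
      have h1 := sum_pert_add_ind m (topDown hr m i) (topSet m i)
      have h2 := (hf.majorized m' hm').2 (topSet m i)
      rw [heq, sum_pert_add_ind] at h1
      rw [card_topSet m hi] at h2
      simp only [topDown, Finset.inter_self] at h1 ⊢
      rw [card_topSet m hi] at h1
      have hSi := (Finset.mem_filter.1 hS).2
      have h3 : (N : ℤ) * i ≤ N * (topSet m i ∩ S.1).card := by linarith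
      have h4 : i ≤ (topSet m i ∩ S.1).card := by
        rcases Nat.eq_zero_or_pos N with h0 | h0
        · omega
        · exact_mod_cast le_of_mul_le_mul_left h3 (by exact_mod_cast h0)
      have h5 := Finset.eq_of_subset_of_card_le
        (Finset.inter_subset_right (s₁ := topSet m i) (s₂ := S.1)) (by rw [hSi]; exact h4)
      have h6 := Finset.eq_of_subset_of_card_le
        (Finset.inter_subset_left (s₁ := topSet m i) (s₂ := S.1))
        (by rw [card_topSet m hi]; exact h4)
      exact h5.symm.trans h6
    · intro h
      exact absurd (by simp [topDown, card_topSet m hi]) h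
  · rw [Finsupp.mem_support_iff, hexp] at hm''
    obtain ⟨S, hS, h⟩ := Finset.exists_ne_zero_of_sum_ne_zero hm''
    obtain ⟨m', hm', rfl⟩ := hcoeff S _ h
    rw [Finset.mem_filter] at hS
    obtain ⟨h1, h2⟩ := hf.majorized m' hm'
    refine ⟨by rw [deg_add, deg_add, h1, deg_ind, deg_ind, add_comm], fun T => ?_⟩
    have hT : T.card ≤ N := by simpa using T.card_le_univ
    rw [add_comm, topSet_congr (rk_add_topDown hr m i), sum_pert_add_ind, sum_pert_add_ind]
    refine add_le_add (h2 T) (mul_le_mul_of_nonneg_left ?_ (by omega))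
    simp only [topDown]
    rw [topSet_inter_topSet, card_topSet m (by omega), Nat.cast_le]
    exact le_min (Finset.card_le_card Finset.inter_subset_left)
      ((Finset.card_le_card Finset.inter_subset_right).trans hS.2.le)

end Hibi

namespace Hibi

variable {N : ℕ} {r : Fin N → Fin N → Prop}

/-! ### A basis over the polynomial ring in the rank sums -/

/-- A strictly increasing function for the majorization order on the monomials of given degree. -/
def height (m : hibiMonoid r) : ℕ :=
  (∑ i ∈ Finset.range (N + 1), ∑ a ∈ topSet m i, pert m a).toNat

lemma pert_nonneg (m : hibiMonoid r) (a : Fin N) : 0 ≤ pert m a := by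
  have := mul_nonneg (Nat.cast_nonneg (α := ℤ) N) (wt_nonneg m a)
  have := a.2
  unfold pert
  omega

lemma topSet_succ (m : hibiMonoid r) (p : Fin N) :
    topSet m (p.val + 1) = insert ((rk m).symm p) (topSet m p.val) := by
  ext a
  rw [Finset.mem_insert, mem_topSet, mem_topSet, Nat.lt_succ_iff_lt_or_eq, or_comm, ← Fin.ext_iff,
    Equiv.eq_symm_apply]

lemma eq_of_sum_topSet_eq {m m' : hibiMonoid r} (hd : deg m' = deg m)
    (h : ∀ i ≤ N, ∑ a ∈ topSet m' i, pert m' a = ∑ a ∈ topSet m i, pert m a) : m' = m := by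
  have key : ∀ p, wt m' ((rk m').symm p) = wt m ((rk m).symm p) ∧
      (rk m).symm p = (rk m').symm p := by
    intro p
    rw [← pert_eq_iff]
    have h1 := h (p.val + 1) p.2
    rw [topSet_succ, topSet_succ, Finset.sum_insert (by simp [mem_topSet]),
      Finset.sum_insert (by simp [mem_topSet]), h p.val p.2.le] at h1
    exact add_right_cancel h1
  refine ext hd fun a => ?_
  obtain ⟨h1, h2⟩ := key (rk m' a)
  rw [h2] at h1
  simpa using h1

lemma height_lt_of_majorized {m m' : hibiMonoid r} (hd : deg m' = deg m)
    (h : ∀ S : Finset (Fin N), ∑ a ∈ S, pert m' a ≤ ∑ a ∈ topSet m S.card, pert m a)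
    (hne : m' ≠ m) : height m' < height m := by
  have h1 : ∀ i ≤ N, ∑ a ∈ topSet m' i, pert m' a ≤ ∑ a ∈ topSet m i, pert m a := by
    intro i hi
    have := h (topSet m' i)
    rwa [card_topSet m' hi] at this
  have h2 : ∃ i ≤ N, ∑ a ∈ topSet m' i, pert m' a < ∑ a ∈ topSet m i, pert m a := by
    by_contra hcon
    push Not at hcon
    exact hne (eq_of_sum_topSet_eq hd fun i hi => le_antisymm (h1 i hi) (hcon i hi))
  obtain ⟨i, hi, hlt⟩ := h2
  have h3 : ∑ i ∈ Finset.range (N + 1), ∑ a ∈ topSet m' i, pert m' a <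
      ∑ i ∈ Finset.range (N + 1), ∑ a ∈ topSet m i, pert m a :=
    Finset.sum_lt_sum (fun i hi => h1 i (by simpa [Nat.lt_succ_iff] using hi))
      ⟨i, by simpa [Nat.lt_succ_iff] using hi, hlt⟩
  have h4 : 0 ≤ ∑ i ∈ Finset.range (N + 1), ∑ a ∈ topSet m' i, pert m' a :=
    Finset.sum_nonneg fun i _ => Finset.sum_nonneg fun a _ => pert_nonneg m' a
  unfold height
  omega

variable (hr : ∀ a b, r a b → a < b)

/-- No indicator function of a top set can be split off. -/
def Reduced (m : hibiMonoid r) : Prop :=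
  ∀ i ≤ N, ∀ m' : hibiMonoid r, m ≠ m' + ind (topDown hr m' i)

/-- The sum of `m` and the indicator functions of its top sets with the given cardinalities. -/
def addTops (m : hibiMonoid r) (α : Multiset (Fin (N + 1))) : hibiMonoid r :=
  m + (α.map fun i => ind (topDown hr m i.val)).sum

lemma rk_addTops_and_addTops_cons (m : hibiMonoid r) (α : Multiset (Fin (N + 1))) :
    rk (addTops hr m α) = rk m ∧ ∀ i, addTops hr m (i ::ₘ α) =
      addTops hr m α + ind (topDown hr (addTops hr m α) i.val) := by
  induction α using Multiset.induction with
  | empty => exact ⟨by simp [addTops], fun i => by simp [addTops]⟩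
  | cons j α ih =>
    have h1 : rk (addTops hr m (j ::ₘ α)) = rk m := by rw [ih.2 j, rk_add_topDown, ih.1]
    refine ⟨h1, fun i => ?_⟩
    rw [topDown_congr hr h1]
    simp only [addTops, Multiset.map_cons, Multiset.sum_cons]
    abel

lemma rk_addTops (m : hibiMonoid r) (α : Multiset (Fin (N + 1))) :
    rk (addTops hr m α) = rk m := (rk_addTops_and_addTops_cons hr m α).1

lemma addTops_cons (m : hibiMonoid r) (i : Fin (N + 1)) (α : Multiset (Fin (N + 1))) :
    addTops hr m (i ::ₘ α) = addTops hr m α + ind (topDown hr (addTops hr m α) i.val) :=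
  (rk_addTops_and_addTops_cons hr m α).2 i

/-- Every element is obtained from a reduced one by adding top sets. -/
lemma exists_addTops_eq (m : hibiMonoid r) :
    ∃ p : {m : hibiMonoid r // Reduced hr m} × Multiset (Fin (N + 1)),
      addTops hr p.1.1 p.2 = m := by
  induction hn : deg m using Nat.strong_induction_on generalizing m with
  | _ n ih =>
    by_cases hm : Reduced hr m
    · exact ⟨(⟨m, hm⟩, 0), by simp [addTops]⟩
    · unfold Reduced at hm
      push Not at hm
      obtain ⟨i, hi, m', rfl⟩ := hm
      obtain ⟨p, hp⟩ := ih (deg m') (by rw [← hn, deg_add, deg_ind]; omega) m' rfl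
      exact ⟨(p.1, ⟨i, by omega⟩ ::ₘ p.2), by rw [addTops_cons, hp]⟩

/-- If a top set of `i` coordinates can be split off, then one of that size was added. -/
lemma mem_of_addTops_eq_add {η m : hibiMonoid r} (hη : Reduced hr η) {i : Fin (N + 1)}
    (α : Multiset (Fin (N + 1))) (h : addTops hr η α = m + ind (topDown hr m i)) : i ∈ α := by
  induction α using Multiset.induction generalizing m with
  | empty =>
    refine absurd ?_ (hη i (by omega) m)
    simpa [addTops] using h
  | cons j α ih =>
    by_cases hij : i = j
    · simp [hij]
    · rw [addTops_cons] at h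
      obtain ⟨m'', hm''⟩ := exists_of_add_topDown_eq hr (i := i) (j := j) (by omega) (by omega)
        (fun h => hij (Fin.ext h).symm) h.symm
      exact Multiset.mem_cons_of_mem (ih hm'')

lemma addTops_injective :
    Function.Injective fun p : {m : hibiMonoid r // Reduced hr m} × Multiset (Fin (N + 1)) =>
      addTops hr p.1.1 p.2 := by
  rintro ⟨⟨η, hη⟩, α⟩ ⟨⟨η', hη'⟩, α'⟩ h
  dsimp only at h
  induction α using Multiset.induction generalizing α' with
  | empty =>
    rcases α'.empty_or_exists_mem with rfl | ⟨j, hj⟩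
    · simpa [addTops] using h
    · obtain ⟨α', rfl⟩ := Multiset.exists_cons_of_mem hj
      rw [addTops_cons] at h
      exact absurd (mem_of_addTops_eq_add hr hη 0 h) (Multiset.notMem_zero _)
  | cons i α ih =>
    have hi : i ∈ α' := by
      refine mem_of_addTops_eq_add hr hη' α' (m := addTops hr η α) ?_
      rw [← h, addTops_cons]
    obtain ⟨α', rfl⟩ := Multiset.exists_cons_of_mem hi
    have hrk : rk (addTops hr η α) = rk (addTops hr η' α') := by
      have := congrArg rk h
      rwa [rk_addTops, rk_addTops, ← rk_addTops hr η α, ← rk_addTops hr η' α'] at this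
    rw [addTops_cons, addTops_cons, topDown_congr hr hrk] at h
    have := ih α' (add_right_cancel h)
    simp only [Prod.mk.injEq] at this ⊢
    exact ⟨this.1, by rw [this.2]⟩

variable (K : Type*) [Field K]

/-- The product of a reduced monomial and of rank sums. -/
noncomputable def basisVec (p : {m : hibiMonoid r // Reduced hr m} × Multiset (Fin (N + 1))) :
    AddMonoidAlgebra K (hibiMonoid r) :=
  (p.2.map fun i => rankSum K r i.val 1).prod * AddMonoidAlgebra.single p.1.1 1

lemma rankSum_mul_basisVec (i : Fin (N + 1)) (η : {m : hibiMonoid r // Reduced hr m})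
    (α : Multiset (Fin (N + 1))) :
    rankSum K r i 1 * basisVec hr K (η, α) = basisVec hr K (η, i ::ₘ α) := by
  simp [basisVec, mul_assoc]

lemma isLead_basisVec (η : {m : hibiMonoid r // Reduced hr m}) (α : Multiset (Fin (N + 1))) :
    IsLead (basisVec hr K (η, α)) (addTops hr η.1 α) := by
  induction α using Multiset.induction with
  | empty => simpa [basisVec, addTops] using isLead_single η.1
  | cons i α ih =>
    rw [← rankSum_mul_basisVec, addTops_cons]
    exact ih.rankSum_mul hr (by omega)

/-- The bijection that sends a basis element to its leading monomial. -/
noncomputable def leadEquiv :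
    {m : hibiMonoid r // Reduced hr m} × Multiset (Fin (N + 1)) ≃ hibiMonoid r :=
  Equiv.ofBijective _ ⟨addTops_injective hr, exists_addTops_eq hr⟩

/-- The algebra of a Hibi monoid is free over the polynomial ring in the rank sums. -/
noncomputable def rankBasis : Module.Basis
    ({m : hibiMonoid r // Reduced hr m} × Multiset (Fin (N + 1))) K
    (AddMonoidAlgebra K (hibiMonoid r)) :=
  have h1 : ∀ m, (basisVec hr K ((leadEquiv hr).symm m)).coeff m = 1 := by
    intro m
    have := (isLead_basisVec hr K ((leadEquiv hr).symm m).1 ((leadEquiv hr).symm m).2).coeff_eq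
    rwa [show addTops hr _ _ = m from (leadEquiv hr).apply_symm_apply m] at this
  have h2 : ∀ m, ∀ m' ∈ (basisVec hr K ((leadEquiv hr).symm m)).coeff.support,
      m' = m ∨ height m' < height m := by
    intro m m' hm'
    have := (isLead_basisVec hr K ((leadEquiv hr).symm m).1
      ((leadEquiv hr).symm m).2).majorized m' hm'
    rw [show addTops hr _ _ = m from (leadEquiv hr).apply_symm_apply m] at this
    by_cases h : m' = m
    · exact Or.inl h
    · exact Or.inr (height_lt_of_majorized this.1 this.2 h)
  ((Module.Basis.mk (linearIndependent_of_unitriangular h1 h2)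
    (span_eq_top_of_unitriangular h1 h2).ge).map
      (AddMonoidAlgebra.coeffLinearEquiv K).symm).reindex (leadEquiv hr).symm

lemma rankBasis_apply (p : {m : hibiMonoid r // Reduced hr m} × Multiset (Fin (N + 1))) :
    rankBasis hr K p = basisVec hr K p := by
  simp [rankBasis]

lemma isWeaklyRegular_rankSum_one (hr : ∀ a b, r a b → a < b) :
    RingTheory.Sequence.IsWeaklyRegular (AddMonoidAlgebra K (hibiMonoid r))
      (List.ofFn fun i : Fin (N + 1) => rankSum K r i 1) :=
  isWeaklyRegular_ofFn_of_basis _ (rankBasis hr K) fun i y α => by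
    rw [rankBasis_apply, rankBasis_apply, rankSum_mul_basisVec]

/-! ### Finiteness and dimension -/

/-- In a reduced element the largest coordinate is the degree, neighbours in the sorted list of the
coordinates differ by at most `1`, and the last one is `0`. -/
lemma Reduced.deg_le {m : hibiMonoid r} (h : Reduced hr m) : deg m ≤ N := by
  rcases Nat.eq_zero_or_pos (deg m) with h0 | hpos
  · omega
  have hgap : ∀ i ≤ N, ¬ BigGap m i := fun i hi hb => by
    obtain ⟨m', hm'⟩ := hb.exists_eq_add hr
    exact h i hi m' hm'
  have hle : ∀ p : ℕ, ∀ hp : p < N, (deg m : ℤ) - p ≤ wt m ((rk m).symm ⟨p, hp⟩) := by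
    intro p
    induction p with
    | zero =>
      intro hp
      by_contra hcon
      refine hgap 0 (by omega) ⟨hpos, fun b _ => ?_, fun a ha => by omega, fun a b ha => by omega⟩
      have := wt_le_of_rk_le (m := m) (a := (rk m).symm ⟨0, hp⟩) (b := b) (by
        rw [Fin.le_def]; simp)
      omega
    | succ p ih =>
      intro hp
      have h1 := ih (by omega)
      by_contra hcon
      have hb : ∀ b, p + 1 ≤ (rk m b).val → wt m b ≤ wt m ((rk m).symm ⟨p + 1, hp⟩) := fun b hb =>
        wt_le_of_rk_le (by rw [Fin.le_def]; simpa using hb)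
      have ha : ∀ a, (rk m a).val < p + 1 → wt m ((rk m).symm ⟨p, by omega⟩) ≤ wt m a := fun a ha =>
        wt_le_of_rk_le (by rw [Fin.le_def]; simp; omega)
      have h0 := wt_nonneg m ((rk m).symm ⟨p + 1, hp⟩)
      push_cast at hcon
      refine hgap (p + 1) hp.le ⟨hpos, fun b hb' => ?_, fun a ha' => ?_, fun a b ha' hb' => ?_⟩
      · have := hb b hb'
        omega
      · have := ha a ha'
        omega
      · have h2 := hb b hb'
        have h3 := ha a ha'
        have := a.2
        have := b.2
        have : (N : ℤ) * (wt m b + 2) ≤ N * wt m a :=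
          mul_le_mul_of_nonneg_left (by omega) (by omega)
        rw [mul_add] at this
        unfold pert
        omega
  by_contra hcon
  refine hgap N le_rfl ⟨hpos, fun b hb => by omega, fun a _ => ?_, fun a b _ hb => by omega⟩
  have h1 := hle (rk m a).val (rk m a).2
  have h2 := (rk m a).2
  simp only [Fin.eta, Equiv.symm_apply_apply] at h1
  omega

instance : Finite {m : hibiMonoid r // Reduced hr m} := by
  have hfin : (Set.Iic N ×ˢ Set.Icc (0 : Fin N → ℤ) fun _ => (N : ℤ)).Finite :=
    (Set.finite_Iic N).prod (Set.finite_Icc _ _)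
  have := hfin.to_subtype
  refine Finite.of_injective (β := (Set.Iic N ×ˢ Set.Icc (0 : Fin N → ℤ) fun _ => (N : ℤ) :))
    (fun m => ⟨m.1.1, ?_⟩) ?_
  · have hd := m.2.deg_le
    refine ⟨hd, fun a => wt_nonneg m.1 a, fun a => ?_⟩
    exact (wt_le_deg m.1 a).trans (Nat.cast_le.2 hd)
  · intro m m' h
    exact Subtype.ext (Subtype.ext (Subtype.mk.inj h))

/-- The algebra is a finite module over the polynomial ring in the rank sums. -/
lemma finite_aeval_rankSum (hr : ∀ a b, r a b → a < b) :
    (MvPolynomial.aeval (R := K) fun i : Fin (N + 1) => rankSum K r i 1).Finite := by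
  let := (MvPolynomial.aeval (R := K) fun i : Fin (N + 1) => rankSum K r i 1).toAlgebra
  change Module.Finite _ _
  refine ⟨Submodule.fg_def.2 ⟨Set.range fun η : {m : hibiMonoid r // Reduced hr m} =>
    AddMonoidAlgebra.single η.1 (1 : K), Set.finite_range _, ?_⟩⟩
  rw [eq_top_iff]
  intro x _
  have hx : x ∈ Submodule.span K (Set.range (rankBasis hr K)) := by simp
  induction hx using Submodule.span_induction with
  | zero => exact zero_mem _
  | add x y _ _ hx hy => exact add_mem (hx trivial) (hy trivial)
  | smul c x _ hx =>
    have : c • x = (MvPolynomial.C c : MvPolynomial (Fin (N + 1)) K) • x := by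
      rw [Algebra.smul_def, Algebra.smul_def]
      change _ = MvPolynomial.aeval _ _ * _
      simp
    rw [this]
    exact Submodule.smul_mem _ _ (hx trivial)
  | mem x hx =>
    obtain ⟨⟨η, α⟩, rfl⟩ := hx
    rw [rankBasis_apply]
    have : basisVec hr K (η, α) = ((α.map fun i => MvPolynomial.X i).prod :
        MvPolynomial (Fin (N + 1)) K) • AddMonoidAlgebra.single η.1 (1 : K) := by
      rw [Algebra.smul_def]
      change _ = MvPolynomial.aeval _ _ * _
      simp [basisVec, map_multiset_prod]
    rw [this]
    exact Submodule.smul_mem _ _ (Submodule.subset_span ⟨η, rfl⟩)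

lemma isNoetherianRing (hr : ∀ a b, r a b → a < b) :
    IsNoetherianRing (AddMonoidAlgebra K (hibiMonoid r)) := by
  let := (MvPolynomial.aeval (R := K) fun i : Fin (N + 1) => rankSum K r i 1).toAlgebra
  have : Module.Finite (MvPolynomial (Fin (N + 1)) K) (AddMonoidAlgebra K (hibiMonoid r)) :=
    finite_aeval_rankSum K hr
  exact IsNoetherianRing.of_finite (MvPolynomial (Fin (N + 1)) K) _

lemma ringKrullDim_le (hr : ∀ a b, r a b → a < b) :
    ringKrullDim (AddMonoidAlgebra K (hibiMonoid r)) ≤ (N + 1 : ℕ) := by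
  let := (MvPolynomial.aeval (R := K) fun i : Fin (N + 1) => rankSum K r i 1).toAlgebra
  have : Module.Finite (MvPolynomial (Fin (N + 1)) K) (AddMonoidAlgebra K (hibiMonoid r)) :=
    finite_aeval_rankSum K hr
  refine (ringKrullDim_le_of_isIntegral (R := MvPolynomial (Fin (N + 1)) K)).trans ?_
  simp

lemma length_le_of_isRegular (hr : ∀ a b, r a b → a < b)
    {rs : List (AddMonoidAlgebra K (hibiMonoid r))}
    (h : RingTheory.Sequence.IsRegular (AddMonoidAlgebra K (hibiMonoid r)) rs) :
    rs.length ≤ N + 1 := by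
  have := isNoetherianRing K hr
  exact_mod_cast (length_le_ringKrullDim_of_isRegular h).trans (ringKrullDim_le K hr)

end Hibi

/-! ### Exchanging and permuting members of regular sequences -/

/-- If `rs, a` is weakly regular and a power of `a` lies in the ideal of `rs, b`, then `rs, b` is
weakly regular: the elements killed by `b` modulo `rs` are killed by that power of `a`. -/
lemma RingTheory.Sequence.IsWeaklyRegular.exchange_last {A : Type*} [CommRing A] {rs : List A}
    {a b : A} (h : IsWeaklyRegular A (rs ++ [a])) {j : ℕ}
    (hj : a ^ j ∈ Ideal.ofList (rs ++ [b])) : IsWeaklyRegular A (rs ++ [b]) := by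
  rw [isWeaklyRegular_append_iff, isWeaklyRegular_singleton_iff] at h ⊢
  refine ⟨h.1, ?_⟩
  have hpow := h.2.pow j
  rw [isSMulRegular_quotient_iff_mem_of_smul_mem] at hpow ⊢
  intro x hx
  refine hpow x ?_
  rw [Ideal.ofList_append, Ideal.ofList_singleton, Submodule.mem_sup] at hj
  obtain ⟨y, hy, z, hz, hyz⟩ := hj
  obtain ⟨c, rfl⟩ := Ideal.mem_span_singleton.1 hz
  rw [smul_eq_mul, Ideal.mul_top, smul_eq_mul] at hx ⊢
  rw [← hyz, add_mul, mul_comm b c, mul_assoc]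
  exact add_mem (Ideal.mul_mem_right _ _ hy) (Ideal.mul_mem_left _ _ hx)

/-- A form of Nakayama's lemma: a homogeneous element of positive degree cannot act surjectively on
a nonzero submodule of the quotient by a homogeneous ideal. -/
lemma Ideal.IsHomogeneous.eq_bot_of_eq_smul {K A : Type*} [Field K] [CommRing A] [Algebra K A]
    (𝒜 : ℕ → Submodule K A) [GradedAlgebra 𝒜] {I : Ideal A} (hI : I.IsHomogeneous 𝒜) {a : A}
    {e : ℕ} (he : 0 < e) (ha : a ∈ 𝒜 e) {L : Submodule A (A ⧸ (I • ⊤ : Submodule A A))}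
    (hL : L = a • L) : L = ⊥ := by
  rw [eq_bot_iff]
  intro x hx
  have hpow : ∀ n : ℕ, L = a ^ n • L := by
    intro n
    induction n with
    | zero => simp
    | succ n ih => rw [pow_succ, mul_smul, ← hL, ← ih]
  obtain ⟨y, rfl⟩ := Submodule.mkQ_surjective _ x
  rw [Submodule.mem_bot, Submodule.mkQ_apply, Submodule.Quotient.mk_eq_zero, smul_eq_mul,
    Ideal.mul_top, hI.mem_iff]
  intro d
  have hx' := hx
  rw [hpow (d + 1)] at hx'
  obtain ⟨z, _, hz⟩ := hx'
  obtain ⟨z, rfl⟩ := Submodule.mkQ_surjective _ z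
  have hz' : a ^ (d + 1) * z - y ∈ I := by
    have : a ^ (d + 1) * z - y ∈ (I • ⊤ : Submodule A A) := by
      rw [← Submodule.Quotient.mk_eq_zero, Submodule.Quotient.mk_sub, sub_eq_zero]
      exact hz
    rwa [smul_eq_mul, Ideal.mul_top] at this
  have h1 := (hI.mem_iff).1 hz' d
  have h2 : a ^ (d + 1) ∈ 𝒜 ((d + 1) * e) := by
    simpa using SetLike.pow_mem_graded (d + 1) ha
  have h3 : (DirectSum.decompose 𝒜 (a ^ (d + 1) * z) d : A) = 0 :=
    DirectSum.coe_decompose_mul_of_left_mem_of_not_le 𝒜 h2 (by nlinarith)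
  rw [DirectSum.decompose_sub, DirectSum.sub_apply, AddSubgroupClass.coe_sub, h3, zero_sub,
    neg_mem_iff] at h1
  exact h1

lemma RingTheory.Sequence.IsWeaklyRegular.perm_of_homogeneous {K A : Type*} [Field K] [CommRing A]
    [Algebra K A] (𝒜 : ℕ → Submodule K A) [GradedAlgebra 𝒜] {rs rs' : List A}
    (h : IsWeaklyRegular A rs) (hp : rs.Perm rs') (hrs : ∀ a ∈ rs, ∃ e, 0 < e ∧ a ∈ 𝒜 e) :
    IsWeaklyRegular A rs' := by
  refine h.prototype_perm hp fun a b rs'' hsub => ?_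
  intro L hL
  obtain ⟨e, he, ha⟩ := hrs a (hsub.subset (by simp))
  refine Ideal.IsHomogeneous.eq_bot_of_eq_smul 𝒜 ?_ he ha hL
  refine Ideal.homogeneous_span 𝒜 _ fun c hc => ?_
  obtain ⟨e, _, hce⟩ := hrs c (hsub.subset (by simp at hc; simp [hc]))
  exact ⟨e, hce⟩

namespace Hibi

variable {N : ℕ} {r : Fin N → Fin N → Prop} (K : Type*) [Field K]

/-! ### Systems of parameters -/

lemma ind_add_ind (S T : {S : Finset (Fin N) // IsDown r S}) :
    ind S + ind T = ind ⟨S.1 ∩ T.1, fun a b h hb => by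
        rw [Finset.mem_inter] at hb ⊢; exact ⟨S.2 a b h hb.1, T.2 a b h hb.2⟩⟩ +
      ind ⟨S.1 ∪ T.1, fun a b h hb => by
        rw [Finset.mem_union] at hb ⊢; exact hb.imp (S.2 a b h) (T.2 a b h)⟩ := by
  refine ext rfl fun a => ?_
  simp only [wt_add, wt_ind, Finset.mem_inter, Finset.mem_union]
  split_ifs <;> simp_all

/-- A prime ideal that contains a rank sum of each rank, with any exponents, contains all monomials
of degree `1`: among those it does not contain, the ones of the smallest rank belong to a unique
down-set, because of the relation `x_S x_T = x_{S ∩ T} x_{S ∪ T}`. -/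
lemma single_ind_mem_of_isPrime {Q : Ideal (AddMonoidAlgebra K (hibiMonoid r))} (hQ : Q.IsPrime)
    (k : ℕ → ℕ) (hpos : ∀ c, 0 < k c) (hk : ∀ c ≤ N, rankSum K r c (k c) ∈ Q)
    (S : {S : Finset (Fin N) // IsDown r S}) :
    AddMonoidAlgebra.single (ind S) 1 ∈ Q := by
  classical
  by_contra hS
  obtain ⟨T, hT, hmin⟩ := Finset.exists_min_image
    (Finset.univ.filter fun S : {S : Finset (Fin N) // IsDown r S} =>
      AddMonoidAlgebra.single (ind S) (1 : K) ∉ Q) (fun S => S.1.card) ⟨S, by simpa using hS⟩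
  simp only [Finset.mem_filter, Finset.mem_univ, true_and] at hT hmin
  have hcard : T.1.card ≤ N := by simpa using T.1.card_le_univ
  have huniq : ∀ T' : {S : Finset (Fin N) // IsDown r S}, T'.1.card = T.1.card → T' ≠ T →
      AddMonoidAlgebra.single (ind T') (1 : K) ∈ Q := by
    intro T' hc hne
    by_contra hT'
    have h1 : AddMonoidAlgebra.single (ind T) (1 : K) * AddMonoidAlgebra.single (ind T') 1 ∉ Q :=
      fun h => (hQ.mem_or_mem h).elim hT hT'
    rw [AddMonoidAlgebra.single_mul_single, ind_add_ind, ← AddMonoidAlgebra.single_mul_single] at h1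
    have h2 := hmin _ fun h => h1 (Ideal.mul_mem_right _ _ h)
    have h3 := Finset.eq_of_subset_of_card_le Finset.inter_subset_left h2
    have h4 := Finset.eq_of_subset_of_card_le (Finset.inter_subset_right (s₁ := T.1) (s₂ := T'.1))
      (by rw [hc]; exact h2)
    exact hne (Subtype.ext (h4.symm.trans h3))
  have h := hk T.1.card hcard
  rw [rankSum, ← Finset.add_sum_erase _ _ (a := T) (by simp)] at h
  have hrest : ∑ S ∈ (Finset.univ.filter fun S : {S : Finset (Fin N) // IsDown r S} =>
      S.1.card = T.1.card).erase T, AddMonoidAlgebra.single (ind S) (1 : K) ^ k T.1.card ∈ Q := by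
    refine Ideal.sum_mem _ fun S hS => Ideal.pow_mem_of_mem _ ?_ _ (hpos _)
    simp only [Finset.mem_erase, Finset.mem_filter, Finset.mem_univ, true_and] at hS
    exact huniq S hS.2 hS.1
  exact hT (hQ.mem_of_pow_mem _ ((Ideal.add_mem_iff_left _ hrest).1 h))

/-- The rank sums with any exponents generate the irrelevant ideal up to radical. -/
lemma rankSum_mem_radical (k : ℕ → ℕ) (hpos : ∀ c, 0 < k c) (c : ℕ) {e : ℕ} (he : 0 < e) :
    rankSum K r c e ∈ (Ideal.span ((fun c => rankSum K r c (k c)) '' Set.Iic N)).radical := by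
  rw [Ideal.radical_eq_sInf, Submodule.mem_sInf]
  rintro Q ⟨hle, hQ⟩
  refine Ideal.sum_mem _ fun S _ => Ideal.pow_mem_of_mem _ ?_ _ he
  exact single_ind_mem_of_isPrime K hQ k hpos
    (fun c hc => hle (Ideal.subset_span ⟨c, hc, rfl⟩)) S

/-- The degree as a homomorphism of monoids. -/
def degHom (r : Fin N → Fin N → Prop) : hibiMonoid r →+ ℕ where
  toFun := deg
  map_zero' := rfl
  map_add' _ _ := rfl

lemma rankSum_mem_gradeBy (c k : ℕ) :
    rankSum K r c k ∈ AddMonoidAlgebra.gradeBy K (degHom r) k := by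
  refine Submodule.sum_mem _ fun S _ => ?_
  have := SetLike.pow_mem_graded (A := AddMonoidAlgebra.gradeBy K (degHom r)) k
    (AddMonoidAlgebra.single_mem_gradeBy (degHom r) (ind S) (1 : K))
  rwa [smul_eq_mul, show degHom r (ind S) = 1 from rfl, mul_one] at this

/-- The rank sums of all ranks form a weakly regular sequence, whatever the exponents. The case of
exponents `1` follows from the basis of leading monomials. The exponents are then changed one at a
time, which keeps the sequence a homogeneous system of parameters. -/
theorem isWeaklyRegular_rankSum (hr : ∀ a b, r a b → a < b) (k : ℕ → ℕ) (hpos : ∀ c, 0 < k c) :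
    IsWeaklyRegular (AddMonoidAlgebra K (hibiMonoid r))
      (List.ofFn fun c : Fin (N + 1) => rankSum K r c (k c)) := by
  classical
  have key : ∀ T : Finset (Fin (N + 1)), IsWeaklyRegular (AddMonoidAlgebra K (hibiMonoid r))
      ((List.finRange (N + 1)).map fun c : Fin (N + 1) =>
        rankSum K r c (if c ∈ T then k c else 1)) := by
    intro T
    induction T using Finset.induction_on with
    | empty =>
      have := isWeaklyRegular_rankSum_one K hr
      rw [List.ofFn_eq_map] at this
      simpa only [Finset.notMem_empty, if_false] using this
    | insert c T hc ih =>
      -- The member of rank `c` is moved to the end, exchanged there, and moved back.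
      set L := (List.finRange (N + 1)).erase c with hL
      have hperm : (List.finRange (N + 1)).Perm (L ++ [c]) :=
        (List.perm_cons_erase (List.mem_finRange c)).trans (List.perm_append_singleton c L).symm
      have hcL : c ∉ L := (List.nodup_finRange _).not_mem_erase
      have hhom : ∀ (k' : Fin (N + 1) → ℕ), (∀ c, 0 < k' c) → ∀ L' : List (Fin (N + 1)),
          ∀ a ∈ L'.map fun c : Fin (N + 1) => rankSum K r c (k' c),
            ∃ e, 0 < e ∧ a ∈ AddMonoidAlgebra.gradeBy K (degHom r) e := by
        intro k' hk' L' a ha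
        obtain ⟨c, _, rfl⟩ := List.mem_map.1 ha
        exact ⟨k' c, hk' c, rankSum_mem_gradeBy K c (k' c)⟩
      have hpos' : ∀ (T : Finset (Fin (N + 1))) (c : Fin (N + 1)),
          0 < if c ∈ T then k c else 1 := by
        intro T c
        split_ifs
        exacts [hpos _, one_pos]
      have h1 := ih.perm_of_homogeneous _ (hperm.map _) (hhom _ (hpos' T) _)
      rw [List.map_append, List.map_singleton] at h1
      have hL' : (L.map fun c : Fin (N + 1) => rankSum K r c (if c ∈ T then k c else 1)) =
          L.map fun d : Fin (N + 1) => rankSum K r d (if d ∈ insert c T then k d else 1) := by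
        refine List.map_congr_left fun d hd => ?_
        have hdc : d ≠ c := fun h => hcL (h ▸ hd)
        simp [Finset.mem_insert, hdc]
      rw [hL'] at h1
      obtain ⟨j, hj⟩ := rankSum_mem_radical (r := r) K
        (fun d => if h : d < N + 1 then (if (⟨d, h⟩ : Fin (N + 1)) ∈ insert c T then k d else 1)
          else 1) (fun d => by split_ifs <;> first | exact hpos _ | exact one_pos) c
        (hpos' T c)
      have h2 := h1.exchange_last (j := j)
        (b := rankSum K r c (if c ∈ insert c T then k c else 1)) (by
          refine Ideal.span_le.2 ?_ hj
          rintro _ ⟨d, hd, rfl⟩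
          refine Ideal.subset_span ?_
          have hd' : d < N + 1 := Nat.lt_succ_of_le hd
          have hmem := hperm.subset (List.mem_finRange (⟨d, hd'⟩ : Fin (N + 1)))
          have := List.mem_map_of_mem
            (f := fun d : Fin (N + 1) => rankSum K r d (if d ∈ insert c T then k d else 1)) hmem
          rw [List.map_append, List.map_singleton] at this
          simp only [hd', dif_pos]
          exact this)
      have h3 : IsWeaklyRegular (AddMonoidAlgebra K (hibiMonoid r)) ((L ++ [c]).map
          fun d : Fin (N + 1) => rankSum K r d (if d ∈ insert c T then k d else 1)) := by
        rw [List.map_append, List.map_singleton]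
        exact h2
      exact h3.perm_of_homogeneous _ (hperm.symm.map _) (hhom _ (hpos' _) _)
  have := key Finset.univ
  rw [List.ofFn_eq_map]
  simpa only [Finset.mem_univ, if_true] using this

end Hibi

/-! ### The monoid of a product of simplices -/

lemma mem_unitSimplex_iff {m : ℕ} {x : Fin m → ℝ} :
    x ∈ unitSimplex m ↔ (∀ j, 0 ≤ x j) ∧ ∑ j, x j ≤ 1 := by
  constructor
  · intro hx
    have hconv : Convex ℝ {x : Fin m → ℝ | (∀ j, 0 ≤ x j) ∧ ∑ j, x j ≤ 1} := by
      intro x hx y hy s t hs ht hst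
      refine ⟨fun j => add_nonneg (mul_nonneg hs (hx.1 j)) (mul_nonneg ht (hy.1 j)), ?_⟩
      simp only [Pi.add_apply, Pi.smul_apply, smul_eq_mul, Finset.sum_add_distrib,
        ← Finset.mul_sum]
      nlinarith [hx.2, hy.2]
    refine convexHull_min ?_ hconv hx
    rintro _ (rfl | ⟨j, rfl⟩)
    · simp
    · refine ⟨fun i => ?_, by simp⟩
      by_cases hij : i = j <;> simp [hij]
  · rintro ⟨h0, h1⟩
    have hc : Convex ℝ (unitSimplex m) := convex_convexHull ℝ _
    have := hc.sum_mem (t := Finset.univ)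
      (w := fun o : Option (Fin m) => o.elim (1 - ∑ j, x j) x)
      (z := fun o => o.elim 0 fun j => Pi.single j 1) ?_ ?_ ?_
    · rw [Fintype.sum_option] at this
      simp only [Option.elim, smul_zero, zero_add] at this
      convert this using 1
      ext j
      simp [Pi.single_apply]
    · rintro (_ | j) _
      · simpa using h1
      · exact h0 j
    · rw [Fintype.sum_option]
      simp
    · rintro (_ | j) _
      · exact zero_mem_unitSimplex m
      · exact subset_convexHull ℝ _ (Set.mem_insert_of_mem _ ⟨j, rfl⟩)

/-- The monoid of all `(d, v)` such that `v` is a lattice point of the `d`-th dilation of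
`(Δ_m)^{×n}`. -/
def segreMonoid (m n : ℕ) : AddSubmonoid (ℕ × (Fin n × Fin m → ℤ)) where
  carrier := {p | (∀ q, 0 ≤ p.2 q) ∧ ∀ i, ∑ j, p.2 (i, j) ≤ p.1}
  zero_mem' := by simp
  add_mem' := by
    rintro x y ⟨h1, h2⟩ ⟨h3, h4⟩
    refine ⟨fun q => add_nonneg (h1 q) (h3 q), fun i => ?_⟩
    have := h2 i
    have := h4 i
    simp only [Prod.snd_add, Pi.add_apply, Prod.fst_add, Finset.sum_add_distrib]
    push_cast
    linarith

lemma mem_dilationLatticePoints_iff {m n d : ℕ} {v : Fin n × Fin m → ℤ} :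
    v ∈ dilationLatticePoints (cartesianPower (unitSimplex m) n) d ↔ (d, v) ∈ segreMonoid m n := by
  change (fun q => (v q : ℝ)) ∈ (d : ℝ) • cartesianPower (unitSimplex m) n ↔
    (∀ q, 0 ≤ v q) ∧ ∀ i, ∑ j, v (i, j) ≤ d
  constructor
  · rintro ⟨p, hp, hpv⟩
    have hv : ∀ q, (v q : ℝ) = d * p q := fun q => (congrFun hpv q).symm
    have hd : (0 : ℝ) ≤ d := Nat.cast_nonneg d
    constructor
    · intro q
      have := mul_nonneg hd ((mem_unitSimplex_iff.1 (hp q.1)).1 q.2)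
      rw [← hv] at this
      exact_mod_cast this
    · intro i
      have := mul_le_mul_of_nonneg_left (mem_unitSimplex_iff.1 (hp i)).2 hd
      rw [Finset.mul_sum, mul_one] at this
      simp only [← hv] at this
      exact_mod_cast this
  · rintro ⟨h0, h1⟩
    refine ⟨fun q => v q / d, fun i => mem_unitSimplex_iff.2 ⟨fun j => ?_, ?_⟩, ?_⟩
    · exact div_nonneg (by exact_mod_cast h0 _) (Nat.cast_nonneg d)
    · rw [← Finset.sum_div]
      refine div_le_one_of_le₀ ?_ (Nat.cast_nonneg d)
      exact_mod_cast h1 i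
    · ext q
      rcases Nat.eq_zero_or_pos d with rfl | hd
      · have h2 : v q ≤ 0 :=
          (Finset.single_le_sum (f := fun j => v (q.1, j)) (fun j _ => h0 _)
            (Finset.mem_univ q.2)).trans (by simpa using h1 q.1)
        have h3 : v q = 0 := le_antisymm h2 (h0 q)
        simp [h3]
      · have : (d : ℝ) ≠ 0 := by positivity
        change (d : ℝ) * (v q / d) = v q
        field_simp

variable {K : Type*} [Field K] {m n : ℕ}

lemma mono_mem_segreAlgebra {d : ℕ} {v : Fin n × Fin m → ℤ} (h : (d, v) ∈ segreMonoid m n) :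
    TLaurent.mono K d v ∈ segreAlgebra K m n :=
  Algebra.subset_adjoin ⟨d, v, mem_dilationLatticePoints_iff.2 h, rfl⟩

lemma mem_segreAlgebra_iff {f : TLaurent K (Fin n × Fin m)} :
    f ∈ segreAlgebra K m n ↔ ∀ g ∈ f.coeff.support, g ∈ segreMonoid m n := by
  constructor
  · intro hf g hg
    have hconv : Convex ℝ (cartesianPower (unitSimplex m) n) := by
      intro p hp q hq s t hs ht hst i
      exact convex_convexHull ℝ _ (hp i) (hq i) hs ht hst
    exact mem_dilationLatticePoints_iff.1 (mem_of_mem_affineSemigroupAlgebra hconv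
      ⟨0, fun i => zero_mem_unitSimplex m⟩ hf g hg)
  · intro h
    rw [← f.sum_coeff_single]
    refine Subalgebra.sum_mem _ fun g hg => ?_
    have : AddMonoidAlgebra.single g (f.coeff g) = f.coeff g • TLaurent.mono K g.1 g.2 := by
      simp [TLaurent.mono]
    rw [this]
    exact Subalgebra.smul_mem _ (mono_mem_segreAlgebra (h g hg)) _

/-- The algebra `K[(Δ_m)^{×n}]` is the algebra of the monoid `segreMonoid m n`. -/
noncomputable def segreEquiv (K : Type*) [Field K] (m n : ℕ) :
    AddMonoidAlgebra K (segreMonoid m n) ≃ₐ[K] segreAlgebra K m n :=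
  AlgEquiv.ofBijective
    ((AddMonoidAlgebra.mapDomainAlgHom K K (segreMonoid m n).subtype).codRestrict
      (segreAlgebra K m n) (fun x => by
        rw [mem_segreAlgebra_iff]
        intro g hg
        obtain ⟨y, _, rfl⟩ := Finset.mem_image.1 (Finsupp.mapDomain_support hg)
        exact y.2))
    (by
      constructor
      · intro x y hxy
        exact AddMonoidAlgebra.mapDomain_injective Subtype.val_injective (congrArg Subtype.val hxy)
      · rintro ⟨f, hf⟩
        have hle : segreAlgebra K m n ≤
            (AddMonoidAlgebra.mapDomainAlgHom K K (segreMonoid m n).subtype).range := by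
          refine Algebra.adjoin_le ?_
          rintro _ ⟨d, v, hv, rfl⟩
          exact ⟨AddMonoidAlgebra.single ⟨(d, v), mem_dilationLatticePoints_iff.1 hv⟩ 1, by
            simp [TLaurent.mono]⟩
        obtain ⟨x, hx⟩ := hle hf
        exact ⟨x, Subtype.ext hx⟩)

lemma coe_segreEquiv_single (p : segreMonoid m n) (c : K) :
    (segreEquiv K m n (AddMonoidAlgebra.single p c) : TLaurent K (Fin n × Fin m)) =
      AddMonoidAlgebra.single p.1 c := by
  change AddMonoidAlgebra.mapDomainAlgHom K K (segreMonoid m n).subtype _ = _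
  simp

/-! ### Comparison with a Hibi monoid -/

/-- The coordinates `(i, j)` in lexicographic order. -/
def blockEquiv (m n : ℕ) : Fin n × Fin m ≃ Fin (m * n) :=
  finProdFinEquiv.trans (finCongr (mul_comm n m))

lemma blockEquiv_val (q : Fin n × Fin m) : (blockEquiv m n q).val = q.2.val + m * q.1.val := rfl

lemma blockEquiv_div (q : Fin n × Fin m) : (blockEquiv m n q).val / m = q.1.val := by
  have := q.2.2
  rw [blockEquiv_val, Nat.add_mul_div_left _ _ (by omega), Nat.div_eq_of_lt this, zero_add]

/-- The disjoint union of `n` chains with `m` elements. -/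
def blockRel (m n : ℕ) (a b : Fin (m * n)) : Prop := a.val / m = b.val / m ∧ a < b

lemma lt_of_blockRel {a b : Fin (m * n)} (h : blockRel m n a b) : a < b := h.2

lemma blockRel_iff {p q : Fin n × Fin m} :
    blockRel m n (blockEquiv m n p) (blockEquiv m n q) ↔ p.1 = q.1 ∧ p.2 < q.2 := by
  rw [blockRel, blockEquiv_div, blockEquiv_div, Fin.lt_def, blockEquiv_val, blockEquiv_val,
    ← Fin.ext_iff, Fin.lt_def]
  refine and_congr_right fun h => ?_
  rw [h]
  omega

/-- The sum of the coordinates from the index `j` on. -/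
def tailSum (v : Fin m → ℤ) (j : ℕ) : ℤ := ∑ l : Fin m with j ≤ l.val, v l

lemma tailSum_eq_add (v : Fin m → ℤ) (j : Fin m) :
    tailSum v j.val = v j + tailSum v (j.val + 1) := by
  rw [tailSum, tailSum, ← Finset.add_sum_erase _ _ (a := j) (by simp)]
  congr 1
  refine Finset.sum_congr (Finset.ext fun l => ?_) fun _ _ => rfl
  simp only [Finset.mem_erase, Finset.mem_filter, Finset.mem_univ, true_and, ne_eq, Fin.ext_iff]
  omega

lemma tailSum_of_le (v : Fin m → ℤ) {j : ℕ} (hj : m ≤ j) : tailSum v j = 0 := by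
  refine Finset.sum_eq_zero fun l hl => ?_
  simp only [Finset.mem_filter, Finset.mem_univ, true_and] at hl
  omega

lemma tailSum_nonneg {v : Fin m → ℤ} (hv : ∀ j, 0 ≤ v j) (j : ℕ) : 0 ≤ tailSum v j :=
  Finset.sum_nonneg fun l _ => hv l

lemma tailSum_le_tailSum {v : Fin m → ℤ} (hv : ∀ j, 0 ≤ v j) {j l : ℕ} (h : j ≤ l) :
    tailSum v l ≤ tailSum v j :=
  Finset.sum_le_sum_of_subset_of_nonneg (fun i hi => by simp at hi ⊢; omega) fun i _ _ => hv i

lemma tailSum_le_sum {v : Fin m → ℤ} (hv : ∀ j, 0 ≤ v j) (j : ℕ) : tailSum v j ≤ ∑ l, v l :=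
  Finset.sum_le_sum_of_subset_of_nonneg (Finset.filter_subset _ _) fun i _ _ => hv i

lemma tailSum_add (v w : Fin m → ℤ) (j : ℕ) : tailSum (v + w) j = tailSum v j + tailSum w j :=
  Finset.sum_add_distrib

/-- A vector is determined by its tail sums, which are arbitrary. -/
lemma tailSum_sub (f : ℕ → ℤ) (hf : f m = 0) {j : ℕ} (hj : j ≤ m) :
    tailSum (fun l : Fin m => f l.val - f (l.val + 1)) j = f j := by
  induction hj using Nat.decreasingInduction with
  | self => rw [tailSum_of_le _ le_rfl, hf]
  | of_succ j hj ih => rw [tailSum_eq_add _ ⟨j, hj⟩, ih]; ring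

lemma sum_tailSum (v : Fin m → ℤ) :
    ∑ j : Fin m, tailSum v j = ∑ l : Fin m, ((l : ℤ) + 1) * v l := by
  simp only [tailSum, Finset.sum_filter]
  rw [Finset.sum_comm]
  refine Finset.sum_congr rfl fun l _ => ?_
  rw [← Finset.sum_filter, Finset.sum_const, nsmul_eq_mul]
  congr 1
  have : (Finset.univ.filter fun j : Fin m => j.val ≤ l.val) =
      Finset.univ.filter fun j : Fin m => j.val < l.val + 1 := by
    ext j; simp
  rw [this, Fin.card_filter_val_lt, min_eq_right l.2]
  push_cast
  ring

/-- The isomorphism with a Hibi monoid, whose coordinates are the tail sums. -/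
noncomputable def segreHibiEquiv (m n : ℕ) : segreMonoid m n ≃+ hibiMonoid (blockRel m n) :=
  AddEquiv.ofBijective
    ({ toFun := fun p => ⟨(p.1.1, fun a => tailSum (fun l => p.1.2 (((blockEquiv m n).symm a).1, l))
          ((blockEquiv m n).symm a).2.val), by
          refine ⟨fun a => tailSum_nonneg (fun l => p.2.1 _) _,
            fun a => (tailSum_le_sum (fun l => p.2.1 _) _).trans (p.2.2 _), fun a b hab => ?_⟩
          obtain ⟨q, rfl⟩ := (blockEquiv m n).surjective a
          obtain ⟨q', rfl⟩ := (blockEquiv m n).surjective b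
          rw [blockRel_iff] at hab
          simp only [Equiv.symm_apply_apply]
          rw [hab.1]
          exact tailSum_le_tailSum (fun l => p.2.1 _) hab.2.le⟩
       map_zero' := by
          refine Hibi.ext rfl fun a => ?_
          change tailSum _ _ = (0 : ℤ)
          exact Finset.sum_eq_zero fun _ _ => rfl
       map_add' := fun p q => Hibi.ext rfl fun a => tailSum_add _ _ _ } :
      segreMonoid m n →+ hibiMonoid (blockRel m n))
    (by
      constructor
      · intro p p' h
        have hd : p.1.1 = p'.1.1 := congrArg Hibi.deg h
        have hw : ∀ i (j : ℕ), tailSum (fun l => p.1.2 (i, l)) j =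
            tailSum (fun l => p'.1.2 (i, l)) j := by
          intro i j
          rcases le_or_gt m j with hj | hj
          · rw [tailSum_of_le _ hj, tailSum_of_le _ hj]
          · have := congrArg (fun x => Hibi.wt x (blockEquiv m n (i, ⟨j, hj⟩))) h
            simpa [Hibi.wt] using this
        refine Subtype.ext (Prod.ext hd (funext fun q => ?_))
        have h1 := hw q.1 q.2.val
        rw [tailSum_eq_add, tailSum_eq_add, hw q.1 (q.2.val + 1)] at h1
        exact add_right_cancel h1
      · intro x
        set f : Fin n → ℕ → ℤ := fun i j =>
          if h : j < m then Hibi.wt x (blockEquiv m n (i, ⟨j, h⟩)) else 0 with hf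
        have hfm : ∀ i, f i m = 0 := fun i => by simp [hf]
        have hmono : ∀ i (j : Fin m), f i (j.val + 1) ≤ f i j.val := by
          intro i j
          simp only [hf, j.2, dif_pos]
          split_ifs with h
          · refine Hibi.wt_antitone x (blockRel_iff.2 ⟨rfl, ?_⟩)
            rw [Fin.lt_def]
            exact Nat.lt_succ_self _
          · exact Hibi.wt_nonneg _ _
        -- The preimage consists of the differences of consecutive coordinates, padded by `0`.
        refine ⟨⟨(Hibi.deg x, fun q => f q.1 q.2.val - f q.1 (q.2.val + 1)),
          fun q => sub_nonneg.2 (hmono _ _), fun i => ?_⟩, Hibi.ext rfl fun a => ?_⟩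
        · have := tailSum_sub (m := m) (f i) (hfm i) (Nat.zero_le m)
          simp only [tailSum, Nat.zero_le, Finset.filter_true] at this
          change ∑ j : Fin m, (f i j.val - f i (j.val + 1)) ≤ (Hibi.deg x : ℤ)
          rw [this]
          simp only [hf]
          split_ifs
          exacts [Hibi.wt_le_deg _ _, by positivity]
        · obtain ⟨⟨i, j⟩, rfl⟩ := (blockEquiv m n).surjective a
          simp only [Hibi.wt, AddMonoidHom.coe_mk, ZeroHom.coe_mk, Equiv.symm_apply_apply]
          rw [tailSum_sub (f i) (hfm i) j.2.le]
          simp [hf, Hibi.wt])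

lemma deg_segreHibiEquiv (p : segreMonoid m n) : Hibi.deg (segreHibiEquiv m n p) = p.1.1 := rfl

lemma wt_segreHibiEquiv (p : segreMonoid m n) (q : Fin n × Fin m) :
    Hibi.wt (segreHibiEquiv m n p) (blockEquiv m n q) = tailSum (fun l => p.1.2 (q.1, l)) q.2 := by
  change tailSum _ _ = _
  simp

lemma sum_wt_segreHibiEquiv (p : segreMonoid m n) :
    ∑ a, Hibi.wt (segreHibiEquiv m n p) a = ∑ q, simplexWeight m n q * p.1.2 q := by
  rw [← (blockEquiv m n).sum_comp]
  simp only [wt_segreHibiEquiv, Fintype.sum_prod_type, sum_tailSum, simplexWeight]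

lemma Hibi.exists_eq_ind {N : ℕ} {r : Fin N → Fin N → Prop} {x : hibiMonoid r} (h : deg x = 1) :
    ∃ S, x = ind S := by
  classical
  have h01 : ∀ a, wt x a = 0 ∨ wt x a = 1 := by
    intro a
    have h1 := wt_nonneg x a
    have h2 := wt_le_deg x a
    rw [h] at h2
    omega
  refine ⟨⟨Finset.univ.filter fun a => wt x a = 1, fun a b hab hb => ?_⟩, ext h fun a => ?_⟩
  · simp only [Finset.mem_filter, Finset.mem_univ, true_and] at hb ⊢
    have := wt_antitone x hab
    have := h01 a
    omega
  · simp only [wt_ind, Finset.mem_filter, Finset.mem_univ, true_and]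
    have := h01 a
    split_ifs <;> omega

lemma Hibi.sum_wt_ind {N : ℕ} {r : Fin N → Fin N → Prop}
    (S : {S : Finset (Fin N) // IsDown r S}) : ∑ a, wt (ind S) a = S.1.card := by
  simp [wt_ind]

/-- The algebra `K[(Δ_m)^{×n}]` as the algebra of a Hibi monoid. -/
noncomputable def hibiSegreEquiv (K : Type*) [Field K] (m n : ℕ) :
    AddMonoidAlgebra K (hibiMonoid (blockRel m n)) ≃ₐ[K] segreAlgebra K m n :=
  (AddMonoidAlgebra.domCongr K K (segreHibiEquiv m n).symm).trans (segreEquiv K m n)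

lemma coe_hibiSegreEquiv_single (x : hibiMonoid (blockRel m n)) (c : K) :
    (hibiSegreEquiv K m n (AddMonoidAlgebra.single x c) : TLaurent K (Fin n × Fin m)) =
      AddMonoidAlgebra.single ((segreHibiEquiv m n).symm x).1 c := by
  rw [hibiSegreEquiv, AlgEquiv.trans_apply, AddMonoidAlgebra.domCongr_single, coe_segreEquiv_single]

/-- The combinatorial degree of a monomial of degree `1` is the number of elements of its down-set,
since `∑ j, j * v (i, j)` is the sum of the tail sums. -/
lemma hibiSegreEquiv_rankSum (c k : ℕ) :
    hibiSegreEquiv K m n (Hibi.rankSum K (blockRel m n) c k) = segreE K m n k c := by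
  classical
  have hset : monicMonomials K (cartesianPower (unitSimplex m) n) (simplexWeight m n) 1 (c : ℤ) =
      (fun S => hibiSegreEquiv K m n (AddMonoidAlgebra.single (Hibi.ind S) 1)) ''
        ((Finset.univ.filter fun S : {S // Hibi.IsDown (blockRel m n) S} => S.1.card = c :
          Finset _) : Set {S // Hibi.IsDown (blockRel m n) S}) := by
    ext x
    constructor
    · rintro ⟨v, hx, hc⟩
      have hv : (1, v) ∈ segreMonoid m n := by
        refine mem_segreAlgebra_iff.1 x.2 (1, v) ?_
        rw [hx]
        simp [TLaurent.mono]
      obtain ⟨S, hS⟩ := Hibi.exists_eq_ind (x := segreHibiEquiv m n ⟨(1, v), hv⟩) rfl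
      refine ⟨S, ?_, Subtype.ext ?_⟩
      · have := sum_wt_segreHibiEquiv (⟨(1, v), hv⟩ : segreMonoid m n)
        rw [hS, Hibi.sum_wt_ind] at this
        have : (S.1.card : ℤ) = c := this.trans hc
        simpa using this
      · rw [coe_hibiSegreEquiv_single, ← hS, AddEquiv.symm_apply_apply, hx]
        rfl
    · rintro ⟨S, hS, rfl⟩
      have hd : ((segreHibiEquiv m n).symm (Hibi.ind S)).1.1 = 1 := by
        rw [← deg_segreHibiEquiv, AddEquiv.apply_symm_apply, Hibi.deg_ind]
      refine ⟨((segreHibiEquiv m n).symm (Hibi.ind S)).1.2, ?_, ?_⟩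
      · rw [coe_hibiSegreEquiv_single, TLaurent.mono, ← hd]
      · rw [← sum_wt_segreHibiEquiv, AddEquiv.apply_symm_apply, Hibi.sum_wt_ind]
        simpa using hS
  have hinj : Function.Injective fun S : {S // Hibi.IsDown (blockRel m n) S} =>
      hibiSegreEquiv K m n (AddMonoidAlgebra.single (Hibi.ind S) 1) := by
    intro S T h
    have := congrArg AddMonoidAlgebra.coeff ((hibiSegreEquiv K m n).injective h)
    exact Hibi.ind_injective (Finsupp.single_left_injective one_ne_zero this)
  rw [segreE, hset, finsum_mem_image hinj.injOn, finsum_mem_coe_finset, Hibi.rankSum, map_sum]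
  simp only [map_pow]

lemma hibiSegreEquiv_rankSum_zero :
    hibiSegreEquiv K m n (Hibi.rankSum K (blockRel m n) 0 1) = segreT K m n := by
  classical
  have h0 : Hibi.IsDown (blockRel m n) ∅ := fun a b _ h => absurd h (Finset.notMem_empty _)
  rw [Hibi.rankSum, Finset.sum_eq_single ⟨∅, h0⟩]
  · rw [pow_one]
    refine Subtype.ext ?_
    rw [coe_hibiSegreEquiv_single]
    have : (segreHibiEquiv m n).symm (Hibi.ind ⟨∅, h0⟩) =
        ⟨(1, 0), ⟨fun _ => le_rfl, fun _ => by simp⟩⟩ := by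
      rw [AddEquiv.symm_apply_eq]
      refine Hibi.ext rfl fun a => ?_
      obtain ⟨q, rfl⟩ := (blockEquiv m n).surjective a
      rw [wt_segreHibiEquiv]
      simp [Hibi.wt_ind, tailSum]
    rw [this]
    rfl
  · intro S hS hne
    exact absurd (Subtype.ext (Finset.card_eq_zero.1 (Finset.mem_filter.1 hS).2)) hne
  · simp

/-! ### Regular sequences of maximal length -/

lemma RingTheory.Sequence.IsRegular.map_ringEquiv {R S : Type*} [CommRing R] [CommRing S]
    (e : R ≃+* S) {rs : List R} (h : IsRegular R rs) : IsRegular S (rs.map e) := by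
  refine (AddEquiv.isRegular_congr (e := e.toAddEquiv) ?_).1 h
  exact List.forall₂_map_right_iff.2 (List.forall₂_same.2 fun r _ x => by simp)

lemma IsRegularOfMaximalLength.map_ringEquiv {R S : Type*} [CommRing R] [CommRing S] (e : R ≃+* S)
    {rs : List R} (h : IsRegularOfMaximalLength rs) : IsRegularOfMaximalLength (rs.map e) := by
  refine ⟨h.1.map_ringEquiv e, fun rs' h' => ?_⟩
  have := h.2 _ (h'.map_ringEquiv e.symm)
  simpa using this

/-- The homomorphism that sends monomials of positive degree to `0`. -/
noncomputable def Hibi.augmentation (K : Type*) [Field K] {N : ℕ} (r : Fin N → Fin N → Prop) :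
    AddMonoidAlgebra K (hibiMonoid r) →ₐ[K] K :=
  AddMonoidAlgebra.lift K K (hibiMonoid r)
    { toFun := fun x => if deg x.toAdd = 0 then 1 else 0
      map_one' := by simp [deg]
      map_mul' := fun x y => by
        have : deg (x * y).toAdd = deg x.toAdd + deg y.toAdd := rfl
        rw [this]
        split_ifs <;> simp_all }

lemma Hibi.augmentation_rankSum {N : ℕ} (r : Fin N → Fin N → Prop) (c : ℕ) {k : ℕ} (hk : 0 < k) :
    augmentation K r (rankSum K r c k) = 0 := by
  rw [rankSum, map_sum]
  refine Finset.sum_eq_zero fun S _ => ?_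
  rw [map_pow, augmentation, AddMonoidAlgebra.lift_single]
  simp [deg_ind, hk.ne']

/-- The augmentation shows that the rank sums generate a proper ideal, and the Krull dimension
bounds the length of all regular sequences. -/
theorem Hibi.isRegularOfMaximalLength_rankSum {N : ℕ} {r : Fin N → Fin N → Prop}
    (hr : ∀ a b, r a b → a < b) (k : ℕ → ℕ) (hpos : ∀ c, 0 < k c) :
    IsRegularOfMaximalLength (List.ofFn fun c : Fin (N + 1) => rankSum K r c (k c)) := by
  refine ⟨⟨isWeaklyRegular_rankSum K hr k hpos, fun h => ?_⟩, fun rs' h' => ?_⟩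
  · have h1 : (1 : AddMonoidAlgebra K (hibiMonoid r)) ∈
        Ideal.ofList (List.ofFn fun c : Fin (N + 1) => rankSum K r c (k c)) := by
      rw [smul_eq_mul, Ideal.mul_top] at h
      rw [← h]
      trivial
    have h2 : Ideal.ofList (List.ofFn fun c : Fin (N + 1) => rankSum K r c (k c)) ≤
        RingHom.ker (augmentation K r) := by
      refine Ideal.span_le.2 fun x hx => ?_
      obtain ⟨c, rfl⟩ := (List.mem_ofFn' _ _).1 hx
      exact augmentation_rankSum r c (hpos c)
    have h3 := h2 h1
    rw [RingHom.mem_ker, map_one] at h3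
    exact one_ne_zero h3
  · simpa using length_le_of_isRegular K hr h'

theorem isRegularOfMaximalLength_segreSequence (K : Type*) [Field K] (m n : ℕ) {k : ℕ}
    (hk : 0 < k) : IsRegularOfMaximalLength (segreSequence K m n k) := by
  -- The element `t` is the rank sum of rank `0` with exponent `1`.
  have h := (Hibi.isRegularOfMaximalLength_rankSum (K := K) (r := blockRel m n)
    (fun a b h => lt_of_blockRel h) (fun c => if c = 0 then 1 else k) (fun c => by
      split_ifs <;> omega)).map_ringEquiv (hibiSegreEquiv K m n).toRingEquiv
  convert h using 1
  rw [List.map_ofFn, List.ofFn_succ, segreSequence]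
  congr 1
  · exact hibiSegreEquiv_rankSum_zero.symm
  · refine congrArg List.ofFn (funext fun i => ?_)
    exact (hibiSegreEquiv_rankSum (i.val + 1) k).symm

/-! ### Leading terms of block elementary symmetric polynomials -/

namespace Young

variable {K : Type*} [Field K] {m n N : ℕ}

/-- A linear functional on the exponent vectors whose coefficients are positive and strictly
decreasing. The exponent of `t` is disregarded. -/
def energy (g : ℕ × (Fin N × Fin 1 → ℤ)) : ℤ := ∑ a : Fin N, ((N : ℤ) - a.val) * g.2 (a, 0)

lemma energy_add (g g' : ℕ × (Fin N × Fin 1 → ℤ)) : energy (g + g') = energy g + energy g' := by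
  simp [energy, mul_add, Finset.sum_add_distrib]

lemma energy_nonneg {g : ℕ × (Fin N × Fin 1 → ℤ)} (hg : ∀ q, 0 ≤ g.2 q) : 0 ≤ energy g :=
  Finset.sum_nonneg fun a _ => mul_nonneg (by have := a.2; omega) (hg _)

/-- The monomial `g` is the leading monomial of `f` with respect to the energy, with
coefficient `1`. -/
structure IsTop (f : TLaurent K (Fin N × Fin 1)) (g : ℕ × (Fin N × Fin 1 → ℤ)) : Prop where
  coeff_eq : f.coeff g = 1
  eq_or_lt : ∀ g' ∈ f.coeff.support, g' = g ∨ energy g' < energy g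

lemma IsTop.mono (d : ℕ) (v : Fin N × Fin 1 → ℤ) : IsTop (TLaurent.mono K d v) (d, v) := by
  refine ⟨by simp [TLaurent.mono], fun g' hg' => Or.inl ?_⟩
  exact Finset.mem_singleton.1 (Finsupp.support_single_subset hg')

lemma IsTop.one : IsTop (1 : TLaurent K (Fin N × Fin 1)) 0 := IsTop.mono 0 0

lemma IsTop.mul {f f' : TLaurent K (Fin N × Fin 1)} {g g' : ℕ × (Fin N × Fin 1 → ℤ)}
    (h : IsTop f g) (h' : IsTop f' g') : IsTop (f * f') (g + g') := by
  classical
  constructor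
  · rw [AddMonoidAlgebra.coeff_mul_add_of_uniqueAdd, h.coeff_eq, h'.coeff_eq, mul_one]
    intro a b ha hb hab
    have hE := congrArg energy hab
    rw [energy_add, energy_add] at hE
    rcases h.eq_or_lt a ha with rfl | h1 <;> rcases h'.eq_or_lt b hb with rfl | h2
    · exact ⟨rfl, rfl⟩
    all_goals omega
  · intro x hx
    obtain ⟨a, ha, b, hb, rfl⟩ := Finset.mem_add.1
      (AddMonoidAlgebra.support_coeff_mul_subset _ _ hx)
    rw [energy_add, energy_add]
    rcases h.eq_or_lt a ha with rfl | h1 <;> rcases h'.eq_or_lt b hb with rfl | h2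
    · exact Or.inl rfl
    all_goals exact Or.inr (by omega)

lemma IsTop.pow {f : TLaurent K (Fin N × Fin 1)} {g : ℕ × (Fin N × Fin 1 → ℤ)}
    (h : IsTop f g) (k : ℕ) : IsTop (f ^ k) (k • g) := by
  induction k with
  | zero => simpa using IsTop.one
  | succ k ih => rw [pow_succ, succ_nsmul]; exact ih.mul h

lemma IsTop.prod {ι : Type*} (s : Finset ι) {f : ι → TLaurent K (Fin N × Fin 1)}
    {g : ι → ℕ × (Fin N × Fin 1 → ℤ)} (h : ∀ i, IsTop (f i) (g i)) :
    IsTop (∏ i ∈ s, f i) (∑ i ∈ s, g i) := by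
  classical
  induction s using Finset.induction_on with
  | empty => simpa using IsTop.one
  | insert i s hi ih => rw [Finset.prod_insert hi, Finset.sum_insert hi]; exact (h i).mul ih

/-- The indicator function of a set of indices, as an exponent vector. -/
def indVec (J : Finset (Fin N)) : Fin N × Fin 1 → ℤ := fun p => if p.1 ∈ J then 1 else 0

lemma mono_mul_mono {ι : Type*} (d d' : ℕ) (v v' : ι → ℤ) :
    TLaurent.mono K d v * TLaurent.mono K d' v' = TLaurent.mono K (d + d') (v + v') := by
  simp [TLaurent.mono, AddMonoidAlgebra.single_mul_single]

lemma prod_X (J : Finset (Fin N)) :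
    ∏ a ∈ J, TLaurent.X K ((a, 0) : Fin N × Fin 1) = TLaurent.mono K 0 (indVec J) := by
  classical
  induction J using Finset.induction_on with
  | empty =>
    rw [Finset.prod_empty]
    rfl
  | insert a J ha ih =>
    rw [Finset.prod_insert ha, ih, TLaurent.X, mono_mul_mono]
    congr 1
    ext ⟨b, c⟩
    have hc : c = 0 := Subsingleton.elim _ _
    subst hc
    by_cases hb : b = a
    · subst hb; simp [indVec, ha]
    · simp [indVec, Finset.mem_insert, hb]

lemma energy_indVec (d : ℕ) (J : Finset (Fin N)) :
    energy (d, indVec J) = ∑ a ∈ J, ((N : ℤ) - a.val) := by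
  simp [energy, indVec]

/-- The elementary symmetric polynomial of degree `l` in the variables of the block `i`. -/
noncomputable def blockEsymm (K : Type*) [Field K] (m n : ℕ) (i : Fin n) (l : ℕ) :
    TLaurent K (Fin (m * n) × Fin 1) :=
  ∑ J ∈ (youngBlock m n i).powersetCard l, ∏ a ∈ J, TLaurent.X K (a, 0)

lemma mem_youngBlock {i : Fin n} {a : Fin (m * n)} :
    a ∈ youngBlock m n i ↔ ((blockEquiv m n).symm a).1 = i := by
  obtain ⟨q, rfl⟩ := (blockEquiv m n).surjective a
  simp only [youngBlock, Finset.mem_filter, Finset.mem_univ, true_and, blockEquiv_div,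
    Equiv.symm_apply_apply, Fin.ext_iff]

/-- The first `l` indices of the block `i`. -/
def firstSet (m n : ℕ) (i : Fin n) (l : ℕ) : Finset (Fin (m * n)) :=
  Finset.univ.filter fun a => ((blockEquiv m n).symm a).1 = i ∧ ((blockEquiv m n).symm a).2.val < l

lemma card_firstSet (i : Fin n) {l : ℕ} (hl : l ≤ m) : (firstSet m n i l).card = l := by
  have : firstSet m n i l = (Finset.univ.filter fun j : Fin m => j.val < l).map
      ⟨fun j => blockEquiv m n (i, j), fun j j' h => by simpa using h⟩ := by
    ext a
    obtain ⟨⟨i', j⟩, rfl⟩ := (blockEquiv m n).surjective a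
    constructor
    · intro h
      simp only [firstSet, Finset.mem_filter, Finset.mem_univ, true_and,
        Equiv.symm_apply_apply] at h
      exact Finset.mem_map.2 ⟨j, by simpa using h.2, by rw [h.1]; rfl⟩
    · intro h
      obtain ⟨j', hj', h⟩ := Finset.mem_map.1 h
      have := (blockEquiv m n).injective h
      simp only [Prod.mk.injEq] at this
      simp only [firstSet, Finset.mem_filter, Finset.mem_univ, true_and,
        Equiv.symm_apply_apply] at hj' ⊢
      exact ⟨this.1.symm, this.2 ▸ hj'⟩
  rw [this, Finset.card_map, Fin.card_filter_val_lt, min_eq_right hl]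

lemma coeff_blockEsymm (i : Fin n) (l : ℕ) (g : ℕ × (Fin (m * n) × Fin 1 → ℤ)) :
    (blockEsymm K m n i l).coeff g =
      ∑ J ∈ (youngBlock m n i).powersetCard l, if ((0, indVec J) : ℕ × _) = g then 1 else 0 := by
  classical
  simp only [blockEsymm, prod_X, AddMonoidAlgebra.coeff_sum, Finsupp.finsetSum_apply, TLaurent.mono,
    AddMonoidAlgebra.coeff_single, Finsupp.single_apply]

lemma exists_of_mem_support_blockEsymm {i : Fin n} {l : ℕ} {g : ℕ × (Fin (m * n) × Fin 1 → ℤ)}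
    (hg : g ∈ (blockEsymm K m n i l).coeff.support) :
    ∃ J ∈ (youngBlock m n i).powersetCard l, g = (0, indVec J) := by
  rw [Finsupp.mem_support_iff, coeff_blockEsymm] at hg
  obtain ⟨J, hJ, h⟩ := Finset.exists_ne_zero_of_sum_ne_zero hg
  refine ⟨J, hJ, ?_⟩
  by_contra hne
  exact h (if_neg (Ne.symm hne))

lemma indVec_injective : Function.Injective (indVec (N := N)) := by
  intro J J' h
  ext a
  have := congrFun h (a, 0)
  simp only [indVec] at this
  split_ifs at this <;> simp_all

lemma isTop_blockEsymm (i : Fin n) {l : ℕ} (hl : l ≤ m) :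
    IsTop (blockEsymm K m n i l) (0, indVec (firstSet m n i l)) := by
  classical
  have hmem : firstSet m n i l ∈ (youngBlock m n i).powersetCard l := by
    rw [Finset.mem_powersetCard]
    refine ⟨fun a ha => ?_, card_firstSet i hl⟩
    rw [mem_youngBlock]
    exact (Finset.mem_filter.1 ha).2.1
  constructor
  · rw [coeff_blockEsymm, Finset.sum_eq_single_of_mem _ hmem]
    · simp
    · intro J _ hne
      refine if_neg fun h => hne (indVec_injective ?_)
      exact congrArg Prod.snd h
  · intro g hg
    obtain ⟨J, hJ, rfl⟩ := exists_of_mem_support_blockEsymm hg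
    rw [Finset.mem_powersetCard] at hJ
    by_cases hne : J = firstSet m n i l
    · exact Or.inl (by rw [hne])
    · right
      rw [energy_indVec, energy_indVec]
      refine Finset.sum_lt_sum_of_card_eq (by rw [hJ.2, card_firstSet i hl]) ?_ hne
      intro a ha b hb
      rw [Finset.mem_sdiff] at ha hb
      have ha1 := mem_youngBlock.1 (hJ.1 ha.1)
      have ha2 := ha.2
      have hb1 := hb.1
      obtain ⟨p, rfl⟩ := (blockEquiv m n).surjective a
      obtain ⟨q, rfl⟩ := (blockEquiv m n).surjective b
      simp only [firstSet, Finset.mem_filter, Finset.mem_univ, true_and,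
        Equiv.symm_apply_apply] at ha1 ha2 hb1
      rw [blockEquiv_val, blockEquiv_val, ha1, hb1.1]
      have : ¬ p.2.val < l := fun h => ha2 ⟨ha1, h⟩
      push_cast
      omega

/-! ### The homomorphism given by block elementary symmetric polynomials -/

/-- The homomorphism that sends `t` to `t` and `x_{i,j}` to the `j`-th elementary symmetric
polynomial in the variables of the `i`-th block. -/
noncomputable def esymmHom (K : Type*) [Field K] (m n : ℕ) :
    AddMonoidAlgebra K (segreMonoid m n) →ₐ[K] TLaurent K (Fin (m * n) × Fin 1) :=
  AddMonoidAlgebra.lift K _ _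
    { toFun := fun p => TLaurent.mono K p.toAdd.1.1 0 *
        ∏ q : Fin n × Fin m, blockEsymm K m n q.1 (q.2 + 1) ^ (p.toAdd.1.2 q).toNat
      map_one' := by
        simp [TLaurent.mono, AddMonoidAlgebra.one_def]
        rfl
      map_mul' := fun p p' => by
        have h : ∀ q, ((p * p').toAdd.1.2 q).toNat =
            (p.toAdd.1.2 q).toNat + (p'.toAdd.1.2 q).toNat := fun q =>
          Int.toNat_add (p.toAdd.2.1 q) (p'.toAdd.2.1 q)
        have h' : TLaurent.mono K (p * p').toAdd.1.1 (0 : Fin (m * n) × Fin 1 → ℤ) =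
            TLaurent.mono K p.toAdd.1.1 0 * TLaurent.mono K p'.toAdd.1.1 0 := by
          rw [mono_mul_mono, add_zero]
          rfl
        simp only [h, h', pow_add, Finset.prod_mul_distrib]
        ring }

lemma esymmHom_single (p : segreMonoid m n) :
    esymmHom K m n (AddMonoidAlgebra.single p 1) = TLaurent.mono K p.1.1 0 *
      ∏ q : Fin n × Fin m, blockEsymm K m n q.1 (q.2 + 1) ^ (p.1.2 q).toNat := by
  rw [esymmHom, AddMonoidAlgebra.lift_single, one_smul]
  rfl

/-- The exponent of the leading monomial of the image of a monomial: its coordinates are the tail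
sums. -/
noncomputable def topExp (p : segreMonoid m n) : ℕ × (Fin (m * n) × Fin 1 → ℤ) :=
  (p.1.1, fun c => Hibi.wt (segreHibiEquiv m n p) c.1)

lemma topExp_injective : Function.Injective (topExp (m := m) (n := n)) := by
  intro p p' h
  apply (segreHibiEquiv m n).injective
  refine Hibi.ext ((Prod.ext_iff.1 h).1) fun a => ?_
  exact congrFun (Prod.ext_iff.1 h).2 (a, 0)

lemma isTop_esymmHom_single (p : segreMonoid m n) :
    IsTop (esymmHom K m n (AddMonoidAlgebra.single p 1)) (topExp p) := by
  rw [esymmHom_single]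
  have h := (IsTop.mono (K := K) p.1.1 (0 : Fin (m * n) × Fin 1 → ℤ)).mul
    (IsTop.prod Finset.univ fun q : Fin n × Fin m =>
      (isTop_blockEsymm (K := K) q.1 (Nat.succ_le_of_lt q.2.2)).pow (p.1.2 q).toNat)
  convert h using 1
  refine Prod.ext ?_ (funext fun c => ?_)
  · simp [topExp, Prod.fst_sum]
  · obtain ⟨a, c⟩ := c
    obtain ⟨⟨i, j⟩, rfl⟩ := (blockEquiv m n).surjective a
    simp only [topExp, Prod.snd_add, Pi.add_apply, Prod.snd_sum, Finset.sum_apply, Prod.smul_snd,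
      Pi.smul_apply, wt_segreHibiEquiv, indVec, firstSet, Finset.mem_filter, Finset.mem_univ,
      true_and, Equiv.symm_apply_apply, Fintype.sum_prod_type, tailSum]
    rw [Pi.zero_apply, zero_add, Finset.sum_eq_single i]
    · rw [Finset.sum_filter]
      refine Finset.sum_congr rfl fun l _ => ?_
      have h0 : 0 ≤ p.1.2 (i, l) := p.2.1 _
      by_cases hjl : j.val ≤ l.val
      · simp [hjl, h0]
      · simp [hjl]
    · intro i' _ hne
      refine Finset.sum_eq_zero fun l _ => ?_
      rw [if_neg fun h => hne h.1.symm, smul_zero]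
    · simp

/-! ### Invariance -/

/-- All monomials of `f` have degree `d` and exponents between `0` and `c`. -/
def SuppLe (f : TLaurent K (Fin N × Fin 1)) (d : ℕ) (c : Fin N → ℤ) : Prop :=
  ∀ g ∈ f.coeff.support, g.1 = d ∧ ∀ a, 0 ≤ g.2 (a, 0) ∧ g.2 (a, 0) ≤ c a

lemma SuppLe.one : SuppLe (1 : TLaurent K (Fin N × Fin 1)) 0 0 := by
  intro g hg
  rw [Finset.mem_singleton.1 (Finsupp.support_single_subset hg)]
  simp

lemma SuppLe.mul {f f' : TLaurent K (Fin N × Fin 1)} {d d' : ℕ} {c c' : Fin N → ℤ}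
    (h : SuppLe f d c) (h' : SuppLe f' d' c') : SuppLe (f * f') (d + d') (c + c') := by
  classical
  intro x hx
  obtain ⟨a, ha, b, hb, rfl⟩ := Finset.mem_add.1
    (AddMonoidAlgebra.support_coeff_mul_subset _ _ hx)
  obtain ⟨h1, h2⟩ := h a ha
  obtain ⟨h3, h4⟩ := h' b hb
  exact ⟨by rw [Prod.fst_add, h1, h3], fun i =>
    ⟨add_nonneg (h2 i).1 (h4 i).1, add_le_add (h2 i).2 (h4 i).2⟩⟩

lemma SuppLe.pow {f : TLaurent K (Fin N × Fin 1)} {c : Fin N → ℤ} (h : SuppLe f 0 c) (k : ℕ) :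
    SuppLe (f ^ k) 0 (k • c) := by
  induction k with
  | zero => simpa using SuppLe.one
  | succ k ih => rw [pow_succ, succ_nsmul]; exact ih.mul h

lemma SuppLe.prod {ι : Type*} (s : Finset ι) {f : ι → TLaurent K (Fin N × Fin 1)}
    {c : ι → Fin N → ℤ} (h : ∀ i, SuppLe (f i) 0 (c i)) :
    SuppLe (∏ i ∈ s, f i) 0 (∑ i ∈ s, c i) := by
  classical
  induction s using Finset.induction_on with
  | empty => simpa using SuppLe.one
  | insert i s hi ih => rw [Finset.prod_insert hi, Finset.sum_insert hi]; exact (h i).mul ih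

lemma suppLe_blockEsymm (i : Fin n) (l : ℕ) : SuppLe (blockEsymm K m n i l) 0
    (fun a => if ((blockEquiv m n).symm a).1 = i then 1 else 0) := by
  intro g hg
  obtain ⟨J, hJ, rfl⟩ := exists_of_mem_support_blockEsymm hg
  refine ⟨rfl, fun a => ?_⟩
  have hsub := (Finset.mem_powersetCard.1 hJ).1
  have : a ∈ J → ((blockEquiv m n).symm a).1 = i := fun h => mem_youngBlock.1 (hsub h)
  simp only [indVec]
  split_ifs <;> simp_all

/-- Every elementary symmetric polynomial of the block `i` has degree at most `1` in each variable
of that block, and `∑ j, v (i, j) ≤ d`. -/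
lemma esymmHom_mem_segreAlgebra (x : AddMonoidAlgebra K (segreMonoid m n)) :
    esymmHom K m n x ∈ segreAlgebra K 1 (m * n) := by
  induction x using AddMonoidAlgebra.induction_linear with
  | zero => rw [map_zero]; exact zero_mem _
  | add x y hx hy => rw [map_add]; exact add_mem hx hy
  | single p c =>
    have hsmul : AddMonoidAlgebra.single p c = c • AddMonoidAlgebra.single p (1 : K) := by simp
    rw [hsmul, map_smul]
    refine Subalgebra.smul_mem _ (mem_segreAlgebra_iff.2 fun g hg => ?_) _
    have h1 : SuppLe (TLaurent.mono K p.1.1 (0 : Fin (m * n) × Fin 1 → ℤ)) p.1.1 0 := by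
      intro g hg
      rw [Finset.mem_singleton.1 (Finsupp.support_single_subset hg)]
      simp
    have h2 := h1.mul (SuppLe.prod Finset.univ fun q : Fin n × Fin m =>
      (suppLe_blockEsymm (K := K) (m := m) q.1 (q.2 + 1)).pow (p.1.2 q).toNat)
    rw [← esymmHom_single] at h2
    obtain ⟨h3, h4⟩ := h2 g hg
    refine ⟨fun q => ?_, fun a => ?_⟩
    · obtain ⟨a, b⟩ := q
      rw [Subsingleton.elim b 0]
      exact (h4 a).1
    · rw [Fintype.sum_unique, h3]
      refine (h4 a).2.trans ?_
      refine le_trans (le_of_eq ?_) (p.2.2 ((blockEquiv m n).symm a).1)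
      simp only [zero_add, Finset.sum_apply, Pi.smul_apply, Fintype.sum_prod_type]
      rw [Finset.sum_eq_single ((blockEquiv m n).symm a).1]
      · refine Finset.sum_congr rfl fun l _ => ?_
        have h0 : 0 ≤ p.1.2 (((blockEquiv m n).symm a).1, l) := p.2.1 _
        simp [h0]
      · intro i _ hne
        simp [hne.symm]
      · simp

lemma permAct_mono (σ : Equiv.Perm (Fin N)) (d : ℕ) (v : Fin N × Fin 1 → ℤ) :
    permAct K σ (TLaurent.mono K d v) = TLaurent.mono K d fun p => v (σ⁻¹ p.1, p.2) := by
  simp [permAct, TLaurent.mono]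

lemma permAct_blockEsymm {σ : Equiv.Perm (Fin (m * n))} (hσ : σ ∈ youngSubgroup m n) (i : Fin n)
    (l : ℕ) : permAct K σ (blockEsymm K m n i l) = blockEsymm K m n i l := by
  classical
  have hblock : (youngBlock m n i).map σ.toEmbedding = youngBlock m n i := by
    refine Finset.eq_of_subset_of_card_le (fun a ha => ?_) (by rw [Finset.card_map])
    obtain ⟨b, hb, rfl⟩ := Finset.mem_map.1 ha
    exact hσ i b hb
  have hJ : ∀ J : Finset (Fin (m * n)), permAct K σ (TLaurent.mono K 0 (indVec J)) =
      TLaurent.mono K 0 (indVec (J.map σ.toEmbedding)) := by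
    intro J
    rw [permAct_mono]
    congr 1
    ext p
    simp only [indVec, Finset.mem_map_equiv]
    rfl
  simp only [blockEsymm, prod_X, map_sum, hJ]
  conv_rhs => rw [← hblock, Finset.powersetCard_map, Finset.sum_map]
  rfl

lemma mem_youngInvariants_iff {f : TLaurent K (Fin (m * n) × Fin 1)} :
    f ∈ youngInvariants K m n ↔
      f ∈ segreAlgebra K 1 (m * n) ∧ ∀ σ ∈ youngSubgroup m n, permAct K σ f = f := by
  simp [youngInvariants, Algebra.mem_inf, Algebra.mem_iInf, AlgHom.mem_equalizer]

lemma esymmHom_mem_youngInvariants (x : AddMonoidAlgebra K (segreMonoid m n)) :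
    esymmHom K m n x ∈ youngInvariants K m n := by
  refine mem_youngInvariants_iff.2 ⟨esymmHom_mem_segreAlgebra x, fun σ hσ => ?_⟩
  induction x using AddMonoidAlgebra.induction_linear with
  | zero => simp
  | add x y hx hy => rw [map_add, map_add, hx, hy]
  | single p c =>
    have hsmul : AddMonoidAlgebra.single p c = c • AddMonoidAlgebra.single p (1 : K) := by simp
    rw [hsmul, map_smul, map_smul, esymmHom_single, map_mul, map_prod]
    simp only [map_pow, permAct_blockEsymm hσ]
    rw [permAct_mono]
    rfl

/-! ### The isomorphism onto the invariants -/

/-- The coefficients at the monomials whose exponents are weakly decreasing in each block. They are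
indexed by the elements of `segreMonoid m n` of which these exponents are the tail sums. -/
noncomputable def dominantPart (K : Type*) [Field K] (m n : ℕ) :
    TLaurent K (Fin (m * n) × Fin 1) →ₗ[K] (segreMonoid m n →₀ K) :=
  Finsupp.lcomapDomain topExp topExp_injective ∘ₗ
    (AddMonoidAlgebra.coeffLinearEquiv K).toLinearMap

lemma dominantPart_apply (f : TLaurent K (Fin (m * n) × Fin 1)) (p : segreMonoid m n) :
    dominantPart K m n f p = f.coeff (topExp p) := rfl

lemma swap_mem_youngSubgroup {a b : Fin (m * n)} (hab : a.val / m = b.val / m) :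
    Equiv.swap a b ∈ youngSubgroup m n := by
  intro i c hc
  simp only [youngBlock, Finset.mem_filter, Finset.mem_univ, true_and] at hc ⊢
  rw [Equiv.swap_apply_def]
  split_ifs with h1 h2
  · rw [← hab, ← h1, hc]
  · rw [hab, ← h2, hc]
  · exact hc

/-- An invariant is determined by its dominant part, since its monomials of the largest energy are
dominant. -/
lemma eq_zero_of_dominantPart_eq_zero {f : TLaurent K (Fin (m * n) × Fin 1)}
    (hf : f ∈ youngInvariants K m n) (h0 : dominantPart K m n f = 0) : f = 0 := by
  rw [mem_youngInvariants_iff] at hf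
  by_contra hne
  have hsupp : f.coeff.support.Nonempty := by
    rw [Finsupp.support_nonempty_iff]
    intro h
    exact hne (AddMonoidAlgebra.coeff_injective h)
  obtain ⟨g, hg, hmax⟩ := Finset.exists_max_image _ energy hsupp
  have hgm := mem_segreAlgebra_iff.1 hf.1 g hg
  have hdom : ∀ a b, blockRel m n a b → g.2 (b, 0) ≤ g.2 (a, 0) := by
    intro a b hab
    by_contra hlt
    rw [not_le] at hlt
    -- Exchanging two increasing exponents of a block would give a monomial of larger energy.
    set σ := Equiv.swap a b with hσ
    set g' : ℕ × (Fin (m * n) × Fin 1 → ℤ) := (g.1, fun p => g.2 (σ⁻¹ p.1, p.2)) with hg'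
    have hcoeff : f.coeff g' = f.coeff g := by
      conv_lhs => rw [← hf.2 σ (swap_mem_youngSubgroup hab.1)]
      refine Finsupp.mapDomain_apply (fun g₁ g₂ h => ?_) f.coeff g
      refine Prod.ext (Prod.ext_iff.1 h).1 (funext fun p => ?_)
      have := congrFun (Prod.ext_iff.1 h).2 (σ p.1, p.2)
      simpa using this
    have hmax' := hmax g' (by
      rw [Finsupp.mem_support_iff, hcoeff]
      exact Finsupp.mem_support_iff.1 hg)
    have hne : a ≠ b := hab.2.ne
    have hdiff : energy g' - energy g = ((b.val : ℤ) - a.val) * (g.2 (b, 0) - g.2 (a, 0)) := by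
      have h1 : energy g' = ∑ c, (((m * n : ℕ) : ℤ) - (σ c).val) * g.2 (c, 0) := by
        rw [energy, ← Equiv.sum_comp σ]
        simp [hg']
      rw [h1, energy, ← Finset.sum_sub_distrib, ← Finset.sum_subset (Finset.subset_univ {a, b}),
        Finset.sum_pair hne]
      · rw [hσ, Equiv.swap_apply_left, Equiv.swap_apply_right]
        ring
      · intro c _ hc
        simp only [Finset.mem_insert, Finset.mem_singleton, not_or] at hc
        rw [hσ, Equiv.swap_apply_of_ne_of_ne hc.1 hc.2, sub_self]
    have hlt' : (a.val : ℤ) < b.val := by exact_mod_cast hab.2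
    nlinarith [mul_pos (sub_pos.2 hlt') (sub_pos.2 hlt)]
  set x : hibiMonoid (blockRel m n) := ⟨(g.1, fun a => g.2 (a, 0)),
    fun a => hgm.1 _, fun a => by simpa using hgm.2 a, hdom⟩ with hx
  have htop : topExp ((segreHibiEquiv m n).symm x) = g := by
    refine Prod.ext ?_ (funext fun p => ?_)
    · change ((segreHibiEquiv m n).symm x).1.1 = g.1
      rw [← deg_segreHibiEquiv, AddEquiv.apply_symm_apply]
      rfl
    · simp only [topExp, AddEquiv.apply_symm_apply]
      obtain ⟨a, b⟩ := p
      rw [Subsingleton.elim b 0]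
      rfl
  have := DFunLike.congr_fun h0 ((segreHibiEquiv m n).symm x)
  rw [dominantPart_apply, htop] at this
  exact Finsupp.mem_support_iff.1 hg this

/-- The images of the monomials are unitriangular with respect to the energy. -/
lemma unitriangular_dominantPart (p : segreMonoid m n) :
    dominantPart K m n (esymmHom K m n (AddMonoidAlgebra.single p 1)) p = 1 ∧
    ∀ p' ∈ (dominantPart K m n (esymmHom K m n (AddMonoidAlgebra.single p 1))).support,
      p' = p ∨ (energy (topExp p')).toNat < (energy (topExp p)).toNat := by
  have h := isTop_esymmHom_single (K := K) p
  refine ⟨h.coeff_eq, fun p' hp' => ?_⟩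
  rw [Finsupp.mem_support_iff, dominantPart_apply, ← Finsupp.mem_support_iff] at hp'
  refine (h.eq_or_lt _ hp').imp (fun h => topExp_injective h) fun h => ?_
  have : 0 ≤ energy (topExp p') := energy_nonneg fun q =>
    Hibi.wt_nonneg (segreHibiEquiv m n p') q.1
  omega

lemma dominantPart_esymmHom (x : AddMonoidAlgebra K (segreMonoid m n)) :
    dominantPart K m n (esymmHom K m n x) = Finsupp.linearCombination K
      (fun p => dominantPart K m n (esymmHom K m n (AddMonoidAlgebra.single p 1))) x.coeff := by
  induction x using AddMonoidAlgebra.induction_linear with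
  | zero => simp
  | add x y hx hy => simp [hx, hy]
  | single p c =>
    have hsmul : AddMonoidAlgebra.single p c = c • AddMonoidAlgebra.single p (1 : K) := by simp
    rw [hsmul, map_smul, map_smul]
    simp

lemma esymmHom_injective : Function.Injective (esymmHom K m n) := by
  intro x y hxy
  have h := congrArg (dominantPart K m n) hxy
  rw [dominantPart_esymmHom, dominantPart_esymmHom] at h
  exact AddMonoidAlgebra.coeff_injective (linearIndependent_of_unitriangular
    (fun p => (unitriangular_dominantPart p).1) (fun p => (unitriangular_dominantPart p).2) h)

lemma exists_esymmHom_eq {f : TLaurent K (Fin (m * n) × Fin 1)} (hf : f ∈ youngInvariants K m n) :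
    ∃ x, esymmHom K m n x = f := by
  have hspan := span_eq_top_of_unitriangular
    (fun p => (unitriangular_dominantPart (K := K) (m := m) (n := n) p).1)
    (fun p => (unitriangular_dominantPart p).2)
  have hmem : dominantPart K m n f ∈ Submodule.span K (Set.range fun p : segreMonoid m n =>
      dominantPart K m n (esymmHom K m n (AddMonoidAlgebra.single p 1))) := by
    rw [hspan]
    trivial
  obtain ⟨c, hc⟩ := (Finsupp.mem_span_range_iff_exists_finsupp).1 hmem
  refine ⟨AddMonoidAlgebra.ofCoeff c, ?_⟩
  rw [← sub_eq_zero]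
  refine eq_zero_of_dominantPart_eq_zero (sub_mem (esymmHom_mem_youngInvariants _) hf) ?_
  rw [map_sub, dominantPart_esymmHom, sub_eq_zero]
  exact hc

/-- The isomorphism from the algebra of a power of a simplex onto the algebra of invariants. -/
noncomputable def esymmEquiv (K : Type*) [Field K] (m n : ℕ) :
    AddMonoidAlgebra K (segreMonoid m n) ≃ₐ[K] youngInvariants K m n :=
  AlgEquiv.ofBijective ((esymmHom K m n).codRestrict _ esymmHom_mem_youngInvariants)
    ⟨fun _ _ h => esymmHom_injective (congrArg Subtype.val h), fun f => by
      obtain ⟨x, hx⟩ := exists_esymmHom_eq f.2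
      exact ⟨x, Subtype.ext hx⟩⟩

lemma coe_esymmEquiv (x : AddMonoidAlgebra K (segreMonoid m n)) :
    (esymmEquiv K m n x : TLaurent K (Fin (m * n) × Fin 1)) = esymmHom K m n x := rfl

/-- The isomorphism from the algebra of invariants, which undoes the substitution of block
elementary symmetric polynomials for the variables. -/
noncomputable def youngEquiv (K : Type*) [Field K] (m n : ℕ) :
    youngInvariants K m n ≃ₐ[K] segreAlgebra K m n :=
  (esymmEquiv K m n).symm.trans (segreEquiv K m n)

lemma youngEquiv_apply_eq {f : TLaurent K (Fin (m * n) × Fin 1)}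
    (x : AddMonoidAlgebra K (segreMonoid m n)) (hx : esymmHom K m n x = f)
    (hf : f ∈ youngInvariants K m n) : youngEquiv K m n ⟨f, hf⟩ = segreEquiv K m n x := by
  rw [youngEquiv, AlgEquiv.trans_apply]
  congr 1
  rw [AlgEquiv.symm_apply_eq]
  exact Subtype.ext (by rw [coe_esymmEquiv, hx])

/-! ### Images of the generators and of the rank sums -/

/-- The exponent vector of the monomial `∏ i, x_{i, j_i}`. -/
def choiceVec (j : Fin n → Fin (m + 1)) : Fin n × Fin m → ℤ :=
  fun q => if (q.2.val + 1 = (j q.1).val) then 1 else 0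

lemma sum_choiceVec (j : Fin n → Fin (m + 1)) (i : Fin n) (f : Fin m → ℤ) :
    ∑ l, f l * choiceVec j (i, l) = if h : j i = 0 then 0 else f ((j i).pred h) := by
  split_ifs with h
  · refine Finset.sum_eq_zero fun l _ => ?_
    simp [choiceVec, h]
  · have hv : ((j i).pred h).val + 1 = (j i).val := by
      rw [Fin.val_pred]
      have : (j i).val ≠ 0 := fun h' => h (Fin.ext h')
      omega
    rw [Finset.sum_eq_single ((j i).pred h)]
    · simp only [choiceVec, hv, if_true, mul_one]
    · intro l _ hl
      have : l.val + 1 ≠ (j i).val := fun h' => hl (Fin.ext (by omega))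
      simp [choiceVec, this]
    · simp

lemma choiceVec_mem (j : Fin n → Fin (m + 1)) : (1, choiceVec j) ∈ segreMonoid m n := by
  refine ⟨fun q => ?_, fun i => ?_⟩
  · simp only [choiceVec]
    split_ifs <;> simp
  · have := sum_choiceVec j i fun _ => 1
    simp only [one_mul] at this
    rw [this]
    split_ifs <;> simp

lemma weight_choiceVec (j : Fin n → Fin (m + 1)) :
    ∑ q, simplexWeight m n q * choiceVec j q = ∑ i, ((j i).val : ℤ) := by
  rw [Fintype.sum_prod_type]
  refine Finset.sum_congr rfl fun i _ => ?_
  have := sum_choiceVec j i fun l => (l : ℤ) + 1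
  simp only [simplexWeight]
  rw [this]
  split_ifs with h
  · simp [h]
  · have : (j i).val ≠ 0 := fun h' => h (Fin.ext h')
    rw [Fin.val_pred]
    omega

lemma choiceVec_injective : Function.Injective (choiceVec (m := m) (n := n)) := by
  intro j j' h
  funext i
  have h1 := sum_choiceVec j i fun l => (l : ℤ) + 1
  have h2 := sum_choiceVec j' i fun l => (l : ℤ) + 1
  rw [h, h2] at h1
  refine Fin.ext ?_
  split_ifs at h1 with h3 h4 h4
  · rw [h3, h4]
  all_goals
    simp only [Fin.val_pred] at h1
    simp only [Fin.ext_iff, Fin.val_zero] at h3 h4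
    omega

lemma exists_choiceVec_eq {v : Fin n × Fin m → ℤ} (hv : (1, v) ∈ segreMonoid m n) :
    ∃ j, choiceVec j = v := by
  have h : ∀ i, ∃ c : Fin (m + 1), ∀ l, v (i, l) = if l.val + 1 = c.val then 1 else 0 := by
    intro i
    by_cases h0 : ∃ l, v (i, l) ≠ 0
    · obtain ⟨l, hl⟩ := h0
      have hpos := hv.1 (i, l)
      have hsum : ∑ l', v (i, l') ≤ 1 := by simpa using hv.2 i
      refine ⟨⟨l.val + 1, by omega⟩, fun l' => ?_⟩
      rw [← Finset.add_sum_erase _ _ (Finset.mem_univ l)] at hsum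
      change 0 ≤ v (i, l) at hpos
      have hrest : 0 ≤ ∑ l' ∈ Finset.univ.erase l, v (i, l') :=
        Finset.sum_nonneg fun l' _ => hv.1 (i, l')
      by_cases hll : l' = l
      · subst hll
        simp only [if_true]
        omega
      · rw [if_neg fun h => hll (Fin.ext (by simpa using h))]
        have h1 := Finset.single_le_sum (f := fun l' => v (i, l')) (fun l' _ => hv.1 (i, l'))
          (Finset.mem_erase.2 ⟨hll, Finset.mem_univ l'⟩)
        have h2 : 0 ≤ v (i, l') := hv.1 (i, l')
        omega
    · push Not at h0
      exact ⟨0, fun l => by simp [h0]⟩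
  choose j hj using h
  exact ⟨j, funext fun q => (hj q.1 q.2).symm⟩

lemma prod_mono {ι κ : Type*} (s : Finset κ) (v : κ → ι → ℤ) :
    ∏ i ∈ s, TLaurent.mono K 0 (v i) = TLaurent.mono K 0 (∑ i ∈ s, v i) := by
  classical
  induction s using Finset.induction_on with
  | empty => rfl
  | insert i s hi ih =>
    rw [Finset.prod_insert hi, Finset.sum_insert hi, ih, mono_mul_mono]

lemma segreMonomial_eq (j : Fin n → Fin (m + 1)) :
    segreMonomial K m n j = TLaurent.mono K 1 (choiceVec j) := by
  have h : ∀ i, (if h : j i = 0 then (1 : TLaurent K (Fin n × Fin m)) else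
      TLaurent.X K (i, (j i).pred h)) =
      TLaurent.mono K 0 fun q => if q.1 = i then choiceVec j q else 0 := by
    intro i
    split_ifs with h
    · change TLaurent.mono K 0 0 = _
      congr 1
      ext q
      by_cases hq : q.1 = i
      · simp [hq, choiceVec, h]
      · simp [hq]
    · rw [TLaurent.X]
      congr 1
      ext ⟨i', l⟩
      have : (j i).val ≠ 0 := fun h' => h (Fin.ext h')
      by_cases hq : i' = i
      · subst hq
        simp only [Pi.single_apply, Prod.mk.injEq, true_and, if_true, choiceVec]
        refine if_congr ?_ rfl rfl
        rw [Fin.ext_iff, Fin.val_pred]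
        omega
      · simp [hq]
  rw [segreMonomial, Finset.prod_congr rfl fun i _ => h i, prod_mono, TLaurent.T, mono_mul_mono,
    zero_add, add_zero]
  congr 1
  ext q
  simp [Finset.sum_apply]

lemma esymmHom_choiceVec (j : Fin n → Fin (m + 1)) :
    esymmHom K m n (AddMonoidAlgebra.single ⟨(1, choiceVec j), choiceVec_mem j⟩ 1) =
      youngGenerator K m n j := by
  rw [esymmHom_single, youngGenerator]
  congr 1
  rw [Fintype.prod_prod_type]
  refine Finset.prod_congr rfl fun i _ => ?_
  change _ = blockEsymm K m n i (j i)
  by_cases h : j i = 0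
  · rw [Finset.prod_eq_one]
    · rw [h]
      simp [blockEsymm]
    · intro l _
      simp [choiceVec, h]
  · have hv : ((j i).pred h).val + 1 = (j i).val := by
      rw [Fin.val_pred]
      have : (j i).val ≠ 0 := fun h' => h (Fin.ext h')
      omega
    rw [Finset.prod_eq_single ((j i).pred h)]
    · simp only [choiceVec, hv, if_true, Int.toNat_one, pow_one]
    · intro l _ hl
      have : l.val + 1 ≠ (j i).val := fun h' => hl (Fin.ext (by omega))
      simp [choiceVec, this]
    · simp

/-- The sum that defines `e^i` runs over the lattice points of degree `1` and weight `i`. -/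
lemma coe_segreE_one {κ : Type*} (s : Finset κ) (v : κ → Fin n × Fin m → ℤ)
    (hv : Function.Injective v) (i : ℕ)
    (h : ∀ u, ((1, u) ∈ segreMonoid m n ∧ ∑ q, simplexWeight m n q * u q = i) ↔
      ∃ c ∈ s, v c = u) :
    (segreE K m n 1 i : TLaurent K (Fin n × Fin m)) = ∑ c ∈ s, TLaurent.mono K 1 (v c) := by
  classical
  have hmem : ∀ c : s, TLaurent.mono K 1 (v c) ∈ segreAlgebra K m n := fun c =>
    mono_mem_segreAlgebra ((h _).2 ⟨c, c.2, rfl⟩).1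
  have hset : monicMonomials K (cartesianPower (unitSimplex m) n) (simplexWeight m n) 1 (i : ℤ) =
      Set.range fun c : s => (⟨_, hmem c⟩ : segreAlgebra K m n) := by
    ext x
    constructor
    · rintro ⟨u, hx, hu⟩
      have hu' : (1, u) ∈ segreMonoid m n := by
        refine mem_segreAlgebra_iff.1 x.2 (1, u) ?_
        rw [hx]
        simp [TLaurent.mono]
      obtain ⟨c, hc, rfl⟩ := (h u).1 ⟨hu', hu⟩
      exact ⟨⟨c, hc⟩, Subtype.ext hx.symm⟩
    · rintro ⟨c, rfl⟩
      exact ⟨v c, rfl, ((h _).2 ⟨c, c.2, rfl⟩).2⟩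
  have hinj : Function.Injective fun c : s => (⟨_, hmem c⟩ : segreAlgebra K m n) := by
    intro c c' hcc
    have h1 := congrArg AddMonoidAlgebra.coeff (congrArg Subtype.val hcc)
    have h2 := Finsupp.single_left_injective (one_ne_zero (α := K)) h1
    exact Subtype.ext (hv (Prod.ext_iff.1 h2).2)
  rw [segreE, hset, finsum_mem_range hinj, finsum_eq_sum_of_fintype]
  simp only [pow_one]
  rw [AddSubmonoidClass.coe_finsetSum]
  exact Finset.sum_coe_sort s fun c => TLaurent.mono K 1 (v c)

lemma coe_segreE_one_eq_sum_choiceVec (i : ℕ) :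
    (segreE K m n 1 i : TLaurent K (Fin n × Fin m)) =
      ∑ j : Fin n → Fin (m + 1) with ∑ a, (j a).val = i, TLaurent.mono K 1 (choiceVec j) := by
  refine coe_segreE_one _ _ choiceVec_injective i fun u => ⟨fun ⟨h1, h2⟩ => ?_, ?_⟩
  · obtain ⟨j, rfl⟩ := exists_choiceVec_eq h1
    refine ⟨j, ?_, rfl⟩
    rw [weight_choiceVec] at h2
    simpa using by exact_mod_cast h2
  · rintro ⟨j, hj, rfl⟩
    refine ⟨choiceVec_mem j, ?_⟩
    rw [weight_choiceVec]
    exact_mod_cast (Finset.mem_filter.1 hj).2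

lemma coe_segreE_one_eq_sum_indVec (i : ℕ) :
    (segreE K 1 N 1 i : TLaurent K (Fin N × Fin 1)) =
      ∑ J : Finset (Fin N) with J.card = i, TLaurent.mono K 1 (indVec J) := by
  have hw : ∀ J : Finset (Fin N), ∑ q, simplexWeight 1 N q * indVec J q = J.card := by
    intro J
    rw [Fintype.sum_prod_type]
    simp [simplexWeight, indVec]
  refine coe_segreE_one _ _ indVec_injective i fun u => ⟨fun ⟨h1, h2⟩ => ?_, ?_⟩
  · have hu : indVec (Finset.univ.filter fun a => u (a, 0) = 1) = u := by
      ext ⟨a, b⟩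
      rw [Subsingleton.elim b 0]
      have h3 : 0 ≤ u (a, 0) := h1.1 _
      have h4 : u (a, 0) ≤ 1 := by simpa using h1.2 a
      simp only [indVec, Finset.mem_filter, Finset.mem_univ, true_and]
      split_ifs <;> omega
    refine ⟨_, ?_, hu⟩
    rw [← hu, hw] at h2
    simpa using by exact_mod_cast h2
  · rintro ⟨J, hJ, rfl⟩
    refine ⟨⟨fun q => ?_, fun a => ?_⟩, ?_⟩
    · simp only [indVec]
      split_ifs <;> simp
    · simp only [indVec, Fintype.sum_unique]
      split_ifs <;> simp
    · rw [hw]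
      exact_mod_cast (Finset.mem_filter.1 hJ).2

/-- A set of indices is given by its intersections with the blocks. -/
lemma sum_youngGenerator (i : ℕ) :
    ∑ j : Fin n → Fin (m + 1) with ∑ a, (j a).val = i, youngGenerator K m n j =
      ∑ J : Finset (Fin (m * n)) with J.card = i, TLaurent.mono K 1 (indVec J) := by
  classical
  have hblock : ∀ a : Fin (m * n), a ∈ youngBlock m n ((blockEquiv m n).symm a).1 := fun a =>
    mem_youngBlock.2 rfl
  have hdisj : ∀ p : Fin n → Finset (Fin (m * n)), (∀ c, p c ⊆ youngBlock m n c) →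
      Set.PairwiseDisjoint (Set.univ : Set (Fin n)) p := by
    intro p hp c _ c' _ hne
    rw [Function.onFun, Finset.disjoint_left]
    intro a ha ha'
    exact hne ((mem_youngBlock.1 (hp c ha)).symm.trans (mem_youngBlock.1 (hp c' ha')))
  have hcardle : ∀ (J : Finset (Fin (m * n))) (c : Fin n), (J ∩ youngBlock m n c).card < m + 1 := by
    intro J c
    have h1 : youngBlock m n c = firstSet m n c m := by
      ext a
      simp [mem_youngBlock, firstSet]
    have h2 := Finset.card_le_card (Finset.inter_subset_right (s₁ := J) (s₂ := youngBlock m n c))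
    have h3 := card_firstSet (m := m) (n := n) c le_rfl
    rw [← h1] at h3
    omega
  have hunion : ∀ J : Finset (Fin (m * n)),
      Finset.univ.biUnion (fun c => J ∩ youngBlock m n c) = J := by
    intro J
    ext a
    simp only [Finset.mem_biUnion, Finset.mem_univ, true_and, Finset.mem_inter]
    exact ⟨fun ⟨_, h, _⟩ => h, fun h => ⟨_, h, hblock a⟩⟩
  have hexp : ∀ j : Fin n → Fin (m + 1), youngGenerator K m n j =
      ∑ p ∈ Fintype.piFinset fun c => (youngBlock m n c).powersetCard (j c),
        TLaurent.mono K 1 (indVec (Finset.univ.biUnion p)) := by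
    intro j
    rw [youngGenerator, Finset.prod_univ_sum, Finset.mul_sum]
    refine Finset.sum_congr rfl fun p hp => ?_
    rw [← Finset.prod_biUnion, prod_X, TLaurent.T, mono_mul_mono, zero_add, add_zero]
    rw [Finset.coe_univ]
    exact hdisj p fun c => (Finset.mem_powersetCard.1 (Fintype.mem_piFinset.1 hp c)).1
  simp only [hexp]
  rw [Finset.sum_sigma']
  refine Finset.sum_bij' (fun x _ => Finset.univ.biUnion x.2)
    (fun J _ => ⟨fun c => ⟨(J ∩ youngBlock m n c).card, hcardle J c⟩,
      fun c => J ∩ youngBlock m n c⟩) ?_ ?_ ?_ ?_ ?_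
  · rintro ⟨j, p⟩ hx
    simp only [Finset.mem_sigma, Finset.mem_filter, Finset.mem_univ, true_and,
      Fintype.mem_piFinset, Finset.mem_powersetCard] at hx ⊢
    rw [Finset.card_biUnion fun c _ c' _ hne =>
      hdisj p (fun c => (hx.2 c).1) (Set.mem_univ c) (Set.mem_univ c') hne, ← hx.1]
    exact Finset.sum_congr rfl fun c _ => (hx.2 c).2
  · intro J hJ
    simp only [Finset.mem_sigma, Finset.mem_filter, Finset.mem_univ, true_and,
      Fintype.mem_piFinset, Finset.mem_powersetCard] at hJ ⊢
    refine ⟨?_, fun c => ⟨Finset.inter_subset_right, trivial⟩⟩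
    rw [← hJ]
    conv_rhs => rw [← hunion J]
    rw [Finset.card_biUnion fun c _ c' _ hne =>
      hdisj (fun c => J ∩ youngBlock m n c) (fun c => Finset.inter_subset_right)
        (Set.mem_univ c) (Set.mem_univ c') hne]
  · rintro ⟨j, p⟩ hx
    simp only [Finset.mem_sigma, Finset.mem_filter, Finset.mem_univ, true_and,
      Fintype.mem_piFinset, Finset.mem_powersetCard] at hx
    have hp : (fun c => Finset.univ.biUnion p ∩ youngBlock m n c) = p := by
      funext c
      ext a
      simp only [Finset.mem_inter, Finset.mem_biUnion, Finset.mem_univ, true_and]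
      constructor
      · rintro ⟨⟨c', hc'⟩, hc⟩
        have h1 := mem_youngBlock.1 ((hx.2 c').1 hc')
        have h2 := mem_youngBlock.1 hc
        rw [← h2, h1]
        exact hc'
      · intro h
        exact ⟨⟨c, h⟩, (hx.2 c).1 h⟩
    have hj : (fun c => (⟨(Finset.univ.biUnion p ∩ youngBlock m n c).card, hcardle _ c⟩ :
        Fin (m + 1))) = j := by
      funext c
      refine Fin.ext ?_
      change (Finset.univ.biUnion p ∩ youngBlock m n c).card = _
      rw [congrFun hp c, (hx.2 c).2]
    exact Sigma.ext hj (heq_of_eq hp)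
  · intro J _
    exact hunion J
  · intro x _
    rfl

/-- The isomorphism undoes the substitution of block elementary symmetric polynomials, and it sends
each of the rank sums to the rank sum of the same rank. -/
theorem exists_youngInvariants_equiv (K : Type*) [Field K] (m n : ℕ) :
    ∃ φ : youngInvariants K m n ≃ₐ[K] segreAlgebra K m n,
      (∀ j : Fin n → Fin (m + 1), ∃ h : youngGenerator K m n j ∈ youngInvariants K m n,
        (φ ⟨youngGenerator K m n j, h⟩ : TLaurent K (Fin n × Fin m)) = segreMonomial K m n j) ∧
      (∀ i : ℕ, ∃ h : (segreE K 1 (m * n) 1 i : TLaurent K (Fin (m * n) × Fin 1)) ∈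
          youngInvariants K m n,
        φ ⟨segreE K 1 (m * n) 1 i, h⟩ = segreE K m n 1 i) := by
  refine ⟨youngEquiv K m n, fun j => ?_, fun i => ?_⟩
  · have hx := esymmHom_choiceVec (K := K) j
    refine ⟨hx ▸ esymmHom_mem_youngInvariants _, ?_⟩
    rw [youngEquiv_apply_eq _ hx, coe_segreEquiv_single, segreMonomial_eq]
    rfl
  · have hx : esymmHom K m n (∑ j : Fin n → Fin (m + 1) with ∑ a, (j a).val = i,
        AddMonoidAlgebra.single ⟨(1, choiceVec j), choiceVec_mem j⟩ 1) =
        segreE K 1 (m * n) 1 i := by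
      rw [map_sum, coe_segreE_one_eq_sum_indVec, ← sum_youngGenerator]
      exact Finset.sum_congr rfl fun j _ => esymmHom_choiceVec j
    refine ⟨hx ▸ esymmHom_mem_youngInvariants _, ?_⟩
    rw [youngEquiv_apply_eq _ hx, map_sum]
    refine Subtype.ext ?_
    rw [coe_segreE_one_eq_sum_choiceVec, AddSubmonoidClass.coe_finsetSum]
    exact Finset.sum_congr rfl fun j _ => coe_segreEquiv_single _ _

end Young

theorem mainTheorem7 :
    (∀ m n k : ℕ, 0 < m → 0 < n → 0 < k →
      (k = 1 ∧ m = 1) ∨ k = 1 ∨ m = 1 ∨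
        (m = 2 ∧ n ≤ 10 ∧ k ≤ 10) ∨ (m = 3 ∧ n = 2 ∧ k ≤ 7) ∨ (m = 4 ∧ n = 2 ∧ k ≤ 3) →
      IsRegularOfMaximalLength (segreSequence ℂ m n k)) ∧
    (∀ m n : ℕ, 0 < m → 0 < n →
      ∃ φ : youngInvariants ℂ m n ≃ₐ[ℂ] segreAlgebra ℂ m n,
        (∀ j : Fin n → Fin (m + 1), ∃ h : youngGenerator ℂ m n j ∈ youngInvariants ℂ m n,
          (φ ⟨youngGenerator ℂ m n j, h⟩ : TLaurent ℂ (Fin n × Fin m)) = segreMonomial ℂ m n j) ∧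
        (∀ i : ℕ, 1 ≤ i → i ≤ m * n →
          ∃ h : (segreE ℂ 1 (m * n) 1 i : TLaurent ℂ (Fin (m * n) × Fin 1)) ∈
              youngInvariants ℂ m n,
            φ ⟨segreE ℂ 1 (m * n) 1 i, h⟩ = segreE ℂ m n 1 i)) := by
  refine ⟨fun m n k _ _ hk _ => isRegularOfMaximalLength_segreSequence ℂ m n hk, fun m n _ _ => ?_⟩
  obtain ⟨φ, h1, h2⟩ := Young.exists_youngInvariants_equiv ℂ m n
  exact ⟨φ, h1, fun i _ _ => h2 i⟩
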